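/- Let $h:(0,1)\to\mathbb R$ be $h(x)=\log x-\log\frac12$ for $x\le\frac12$ and $h(x)=\log\frac12-\log(1-x)$ for $x\ge\frac12$. Let $C(I)$ be the set of continuous maps $f$ of $[0,1]$ onto itself with $f(0)=0$, $f(1)=1$, $f((0,1))\subset(0,1)$, whose (one-sided) derivatives $f'(0),f'(1)$ exist and lie in $(0,\infty)$, with the metric $d(f,g)=\sup_{x\in(0,1)}|h(f(x))-h(g(x))|$. Let $\mathrm{RDS}(I)$ be the set of triples $f=(f_0,f_1,p)\in C(I)\times C(I)\times(0,1)$ such that $f_0,f_1$ are homeomorphisms, $f_0(x)<x<f_1(x)$ for all $x\in(0,1)$, and $p\log f_0'(j)+(1-p)\log f_1'(j)>0$ for $j=0,1$, with the metric $\max\{d(f_0,g_0),d(f_1,g_1),|p_f-p_g|\}$. A Borel probability measure $\mu$ on $(0,1)$ is stationary for $f$ if $\mu(A)=p\,\mu(f_0^{-1}(A))+(1-p)\,\mu(f_1^{-1}(A))$ for all Borel sets $A\subset(0,1)$. Theorem. The space $\mathrm{RDS}(I)$ is a Baire space. Every $f\in\mathrm{RDS}(I)$ has a unique stationary probability measure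 $\mu_f$ on $(0,1)$, and $\mu_f$ has no atoms. The set of those $f\in\mathrm{RDS}(I)$ for which $\mu_f$ is singular with respect to Lebesgue measure, has full support (every non-empty open subset of $(0,1)$ has positive $\mu_f$-measure) and has no atoms is a dense $G_\delta$ subset of $\mathrm{RDS}(I)$; in particular it is residual. -/

import Mathlib

open Set MeasureTheory Filter Topology

namespace IntervalRDS

/-- The open unit interval `(0, 1)` as a type. It carries the Euclidean topology, the Borel
σ-algebra. -/
abbrev OpenI : Type := ↥(Ioo (0 : ℝ) 1)

/-- Lebesgue measure on `(0, 1)`. -/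
noncomputable def lebesgue : Measure OpenI := (volume : Measure ℝ).comap Subtype.val

/-- The homeomorphism `h : (0, 1) → ℝ` (only its values on `(0, 1)` are ever used). -/
noncomputable def h (x : ℝ) : ℝ :=
  if x ≤ 1 / 2 then Real.log x - Real.log (1 / 2) else Real.log (1 / 2) - Real.log (1 - x)

/-- The metric `d_h` on `(0, 1)` induced by `h`. -/
noncomputable def dh (x y : OpenI) : ℝ := |h x - h y|

/-- A self-map of `[0, 1]`, read as a real function on `ℝ` that is constant outside `[0, 1]`;
only its values on `[0, 1]` matter below. -/
noncomputable def realExt (f : C(unitInterval, unitInterval)) : ℝ → ℝ :=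
  IccExtend (zero_le_one (α := ℝ)) (fun x : unitInterval => (f x : ℝ))

/-- The derivative of a self-map of `[0, 1]` at a point of `[0, 1]`, taken within `[0, 1]`
(one-sided at the endpoints). -/
noncomputable def derivI (f : C(unitInterval, unitInterval)) (x : unitInterval) : ℝ :=
  derivWithin (realExt f) (Icc 0 1) x

/-- The space `C(I)`: continuous maps of `[0, 1]` onto itself that fix both endpoints, map
`(0, 1)` into `(0, 1)` and have finite, strictly positive derivatives at both endpoints. -/
structure CI where
  toMap : C(unitInterval, unitInterval)
  surj : Function.Surjective toMap
  map_zero : toMap 0 = 0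
  map_one : toMap 1 = 1
  map_Ioo : ∀ x ∈ Ioo (0 : unitInterval) 1, toMap x ∈ Ioo (0 : unitInterval) 1
  diff_zero : DifferentiableWithinAt ℝ (realExt toMap) (Icc 0 1) 0
  diff_one : DifferentiableWithinAt ℝ (realExt toMap) (Icc 0 1) 1
  deriv_zero_pos : 0 < derivI toMap 0
  deriv_one_pos : 0 < derivI toMap 1

/-- The restriction of `f ∈ C(I)` to a self-map of `(0, 1)`. -/
def CI.onOpen (f : CI) (x : OpenI) : OpenI :=
  ⟨f.toMap ⟨x, x.2.1.le, x.2.2.le⟩, (f.map_Ioo ⟨x, x.2.1.le, x.2.2.le⟩ ⟨x.2.1, x.2.2⟩).1,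
    (f.map_Ioo ⟨x, x.2.1.le, x.2.2.le⟩ ⟨x.2.1, x.2.2⟩).2⟩

/-- The distance on `C(I)`: the supremum over `(0, 1)` of `d_h (f x) (g x)`. -/
noncomputable def distCI (f g : CI) : ℝ := ⨆ x : OpenI, dh (f.onOpen x) (g.onOpen x)

/-! Finiteness of the supremum and the metric axioms. -/

lemma linear_bounds {F : ℝ → ℝ} {a : ℝ} (hF : ContinuousOn F (Icc 0 1)) (h0 : F 0 = 0)
    (hpos : ∀ x ∈ Ioc (0 : ℝ) 1, 0 < F x) (hd : HasDerivWithinAt F a (Icc 0 1) 0) (ha : 0 < a) :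
    ∃ c C : ℝ, 0 < c ∧ c ≤ 1 ∧ 1 ≤ C ∧ ∀ x ∈ Ioo (0 : ℝ) 1, c * x ≤ F x ∧ F x ≤ C * x := by
  classical
  let q : ℝ → ℝ := Function.update (slope F 0) 0 a
  have hq0 : q 0 = a := by simp [q]
  have hq : ∀ x, x ≠ 0 → q x = F x / x := by
    intro x hx
    simp [q, hx, slope_def_field, h0]
  have hcont : ContinuousOn q (Icc 0 1) := by
    intro x hx
    by_cases hx0 : x = 0
    · subst hx0
      have := hasDerivWithinAt_iff_tendsto_slope.1 hd
      exact continuousWithinAt_update_same.2 this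
    · have h1 : ContinuousWithinAt (fun y => F y / y) (Icc 0 1) x :=
        (hF x hx).div continuousWithinAt_id hx0
      refine h1.congr_of_eventuallyEq ?_ (hq x hx0)
      filter_upwards [mem_nhdsWithin_of_mem_nhds (isOpen_ne.mem_nhds hx0)] with y hy
      exact hq y hy
  have hne : (Icc (0 : ℝ) 1).Nonempty := ⟨0, by simp⟩
  obtain ⟨m, hm, hmin⟩ := isCompact_Icc.exists_isMinOn hne hcont
  obtain ⟨M, hM, hmax⟩ := isCompact_Icc.exists_isMaxOn hne hcont
  have hqm : 0 < q m := by
    by_cases hm0 : m = 0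
    · rw [hm0, hq0]; exact ha
    · rw [hq m hm0]
      have hmp : 0 < m := lt_of_le_of_ne hm.1 (Ne.symm hm0)
      exact div_pos (hpos m ⟨hmp, hm.2⟩) hmp
  refine ⟨min (q m) 1, max (q M) 1, lt_min hqm one_pos, min_le_right _ _, le_max_right _ _, ?_⟩
  intro x hx
  have hxI : x ∈ Icc (0 : ℝ) 1 := ⟨hx.1.le, hx.2.le⟩
  have e : F x = q x * x := by
    rw [hq x hx.1.ne']; field_simp [hx.1.ne']
  rw [e]
  exact ⟨mul_le_mul_of_nonneg_right ((min_le_left _ _).trans (hmin hxI)) hx.1.le,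
    mul_le_mul_of_nonneg_right ((show q x ≤ q M from hmax hxI).trans (le_max_left _ _)) hx.1.le⟩

lemma realExt_apply (f : C(unitInterval, unitInterval)) (x : ℝ) (hx : x ∈ Icc (0 : ℝ) 1) :
    realExt f x = f ⟨x, hx⟩ := IccExtend_of_mem _ _ hx

lemma continuous_realExt (f : C(unitInterval, unitInterval)) : Continuous (realExt f) :=
  (continuous_subtype_val.comp f.continuous).Icc_extend'

lemma CI.realExt_zero (f : CI) : realExt f.toMap 0 = 0 := by
  rw [realExt_apply _ _ ⟨le_rfl, zero_le_one⟩]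
  exact congrArg Subtype.val f.map_zero

lemma CI.realExt_one (f : CI) : realExt f.toMap 1 = 1 := by
  rw [realExt_apply _ _ ⟨zero_le_one, le_rfl⟩]
  exact congrArg Subtype.val f.map_one

lemma CI.realExt_open (f : CI) (x : OpenI) : realExt f.toMap x = f.onOpen x :=
  realExt_apply _ _ _

lemma CI.bounds_zero (f : CI) : ∃ c C : ℝ, 0 < c ∧ c ≤ 1 ∧ 1 ≤ C ∧
    ∀ x : OpenI, c * x ≤ f.onOpen x ∧ (f.onOpen x : ℝ) ≤ C * x := by
  obtain ⟨c, C, h1, h2, h3, h4⟩ := linear_bounds (continuous_realExt f.toMap).continuousOn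
    f.realExt_zero (fun x hx => by
      rcases hx.2.lt_or_eq with hlt | rfl
      · rw [f.realExt_open ⟨x, hx.1, hlt⟩]; exact (f.onOpen _).2.1
      · rw [f.realExt_one]; exact one_pos) f.diff_zero.hasDerivWithinAt f.deriv_zero_pos
  refine ⟨c, C, h1, h2, h3, fun x => ?_⟩
  rw [← f.realExt_open]
  exact h4 x x.2

lemma CI.bounds_one (f : CI) : ∃ c C : ℝ, 0 < c ∧ c ≤ 1 ∧ 1 ≤ C ∧
    ∀ x : OpenI, c * (1 - x) ≤ 1 - f.onOpen x ∧ 1 - (f.onOpen x : ℝ) ≤ C * (1 - x) := by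
  have hd : HasDerivWithinAt (fun x => 1 - realExt f.toMap (1 - x)) (derivI f.toMap 1)
      (Icc 0 1) 0 := by
    have h1 : HasDerivWithinAt (fun x : ℝ => 1 - x) (-1) (Icc 0 1) 0 := by
      simpa using (hasDerivWithinAt_id (0 : ℝ) (Icc 0 1)).const_sub 1
    have h2 : HasDerivWithinAt (realExt f.toMap) (derivI f.toMap 1) (Icc 0 1)
        ((fun x : ℝ => 1 - x) 0) := by
      simpa [derivI] using f.diff_one.hasDerivWithinAt
    have h3 := (HasDerivWithinAt.comp (0 : ℝ) h2 h1
      (fun x hx => ⟨by linarith [hx.2], by linarith [hx.1]⟩)).const_sub 1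
    simpa [Function.comp_def] using h3
  obtain ⟨c, C, h1, h2, h3, h4⟩ := linear_bounds
    (F := fun x => 1 - realExt f.toMap (1 - x))
    ((continuous_const.sub ((continuous_realExt f.toMap).comp
      (continuous_const.sub continuous_id))).continuousOn)
    (by simp [f.realExt_one]) (fun x hx => by
      rcases hx.2.lt_or_eq with hlt | rfl
      · have := f.realExt_open ⟨1 - x, by linarith, by linarith [hx.1]⟩
        have h' := (f.onOpen ⟨1 - x, by linarith, by linarith [hx.1]⟩).2.2
        dsimp only at this ⊢
        rw [this]; linarith
      · simp [f.realExt_zero]) hd f.deriv_one_pos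
  refine ⟨c, C, h1, h2, h3, fun x => ?_⟩
  have := h4 (1 - x) ⟨by linarith [x.2.2], by linarith [x.2.1]⟩
  rw [← f.realExt_open]
  simpa using this

lemma h_diff_bound {c C u v : ℝ} (hc : 0 < c) (hc1 : c ≤ 1) (hC : 1 ≤ C)
    (hu : u ∈ Ioo (0 : ℝ) 1) (hv : v ∈ Ioo (0 : ℝ) 1)
    (h1 : c * v ≤ u) (h2 : u ≤ C * v) (h3 : c * (1 - v) ≤ 1 - u) (h4 : 1 - u ≤ C * (1 - v)) :
    |h u - h v| ≤ 2 * (Real.log C - Real.log c) := by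
  obtain ⟨hu0, hu1⟩ := hu
  obtain ⟨hv0, hv1⟩ := hv
  have hCp : 0 < C := by linarith
  have lc : Real.log c ≤ 0 := Real.log_nonpos hc.le hc1
  have lC : 0 ≤ Real.log C := Real.log_nonneg hC
  have hu' : 0 < 1 - u := by linarith
  have hv' : 0 < 1 - v := by linarith
  have l1 := Real.log_le_log (by positivity) h1
  have l2 := Real.log_le_log hu0 h2
  have l3 := Real.log_le_log (by positivity) h3
  have l4 := Real.log_le_log hu' h4
  rw [Real.log_mul hc.ne' hv0.ne'] at l1
  rw [Real.log_mul hCp.ne' hv0.ne'] at l2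
  rw [Real.log_mul hc.ne' hv'.ne'] at l3
  rw [Real.log_mul hCp.ne' hv'.ne'] at l4
  unfold h
  split_ifs with a b b
  · rw [abs_le]; constructor <;> linarith
  · have a1 := Real.log_le_log hu0 a
    have a2 := Real.log_le_log (by norm_num : (0 : ℝ) < 1 / 2) (not_le.1 b).le
    have a3 := Real.log_le_log hv' (by linarith [not_le.1 b] : 1 - v ≤ 1 / 2)
    have a4 := Real.log_le_log (by norm_num : (0 : ℝ) < 1 / 2) (by linarith : 1 / 2 ≤ 1 - u)
    rw [abs_le]; constructor <;> linarith
  · have a1 := Real.log_le_log hv0 b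
    have a2 := Real.log_le_log (by norm_num : (0 : ℝ) < 1 / 2) (not_le.1 a).le
    have a3 := Real.log_le_log hu' (by linarith [not_le.1 a] : 1 - u ≤ 1 / 2)
    have a4 := Real.log_le_log (by norm_num : (0 : ℝ) < 1 / 2) (by linarith : 1 / 2 ≤ 1 - v)
    rw [abs_le]; constructor <;> linarith
  · rw [abs_le]; constructor <;> linarith

lemma CI.dh_self_bounded (f : CI) : ∃ K : ℝ, ∀ x : OpenI, dh (f.onOpen x) x ≤ K := by
  obtain ⟨c, C, h1, h2, h3, h4⟩ := f.bounds_zero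
  obtain ⟨c', C', h1', h2', h3', h4'⟩ := f.bounds_one
  refine ⟨2 * (Real.log (max C C') - Real.log (min c c')), fun x => ?_⟩
  have x0 : (0 : ℝ) ≤ x := x.2.1.le
  have x1 : (0 : ℝ) ≤ 1 - x := by linarith [x.2.2]
  refine h_diff_bound (lt_min h1 h1') ((min_le_left _ _).trans h2)
    (h3.trans (le_max_left _ _)) (f.onOpen x).2 x.2 ?_ ?_ ?_ ?_
  · exact (mul_le_mul_of_nonneg_right (min_le_left _ _) x0).trans (h4 x).1
  · exact (h4 x).2.trans (mul_le_mul_of_nonneg_right (le_max_left _ _) x0)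
  · exact (mul_le_mul_of_nonneg_right (min_le_right _ _) x1).trans (h4' x).1
  · exact (h4' x).2.trans (mul_le_mul_of_nonneg_right (le_max_right _ _) x1)

lemma dh_comm (x y : OpenI) : dh x y = dh y x := abs_sub_comm _ _

lemma dh_triangle (x y z : OpenI) : dh x z ≤ dh x y + dh y z := abs_sub_le _ _ _

lemma distCI_bddAbove (f g : CI) :
    BddAbove (range fun x : OpenI => dh (f.onOpen x) (g.onOpen x)) := by
  obtain ⟨K, hK⟩ := f.dh_self_bounded
  obtain ⟨L, hL⟩ := g.dh_self_bounded
  refine ⟨K + L, ?_⟩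
  rintro _ ⟨x, rfl⟩
  exact (dh_triangle _ x _).trans (add_le_add (hK x) ((dh_comm _ _).le.trans (hL x)))

lemma h_injOn : InjOn h (Ioo 0 1) := by
  intro u hu v hv huv
  have aux : ∀ x ∈ Ioo (0 : ℝ) 1, ¬ x ≤ 1 / 2 → 0 < Real.log (1 / 2) - Real.log (1 - x) := by
    intro x hx hx2
    have := Real.log_lt_log (by linarith [hx.2]) (by linarith [not_le.1 hx2] : 1 - x < 1 / 2)
    linarith
  have aux2 : ∀ x ∈ Ioo (0 : ℝ) 1, x ≤ 1 / 2 → Real.log x - Real.log (1 / 2) ≤ 0 := by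
    intro x hx hx2
    have := Real.log_le_log hx.1 hx2
    linarith
  unfold h at huv
  split_ifs at huv with a b b
  · exact Real.log_injOn_pos hu.1 hv.1 (by linarith)
  · linarith [aux v hv b, aux2 u hu a]
  · linarith [aux u hu a, aux2 v hv b]
  · have := Real.log_injOn_pos (show 1 - u ∈ Ioi (0 : ℝ) from show (0 : ℝ) < 1 - u from by linarith [hu.2])
      (show 1 - v ∈ Ioi (0 : ℝ) from show (0 : ℝ) < 1 - v from by linarith [hv.2]) (by linarith)
    linarith

lemma CI.ext_onOpen {f g : CI} (hfg : ∀ x, f.onOpen x = g.onOpen x) : f = g := by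
  have : f.toMap = g.toMap := by
    ext x
    rcases x.2.1.eq_or_lt with h0 | h0
    · have : x = 0 := Subtype.ext h0.symm
      rw [this, f.map_zero, g.map_zero]
    rcases x.2.2.eq_or_lt with h1 | h1
    · have : x = 1 := Subtype.ext h1
      rw [this, f.map_one, g.map_one]
    exact congrArg (fun y : OpenI => (y : ℝ)) (hfg ⟨x, h0, h1⟩)
  cases f; cases g; cases this; rfl

/-- `C(I)` as a metric space with the distance `distCI`. -/
noncomputable instance : MetricSpace CI where
  dist := distCI
  dist_self f := by simp [distCI, dh]
  dist_comm f g := by simp only [distCI, dh_comm]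
  dist_triangle f g k := by
    have : Nonempty OpenI := ⟨⟨1 / 2, by norm_num, by norm_num⟩⟩
    exact ciSup_le fun x => (dh_triangle _ (g.onOpen x) _).trans
      (add_le_add (le_ciSup (distCI_bddAbove f g) x) (le_ciSup (distCI_bddAbove g k) x))
  eq_of_dist_eq_zero {f g} hfg := by
    refine CI.ext_onOpen fun x => ?_
    have h1 : dh (f.onOpen x) (g.onOpen x) ≤ 0 :=
      (le_ciSup (distCI_bddAbove f g) x).trans (le_of_eq hfg)
    have h2 : h (f.onOpen x) - h (g.onOpen x) = 0 :=
      abs_eq_zero.1 (le_antisymm h1 (abs_nonneg _))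
    exact Subtype.ext (h_injOn (f.onOpen x).2 (g.onOpen x).2 (sub_eq_zero.1 h2))

/-- The Lyapunov exponent at the endpoint `j ∈ {0, 1}` of the triple `(f₀, f₁, p)`. -/
noncomputable def lyapunov (s : CI × CI × unitInterval) (j : unitInterval) : ℝ :=
  s.2.2 * Real.log (derivI s.1.toMap j) + (1 - s.2.2) * Real.log (derivI s.2.1.toMap j)

/-- The conditions that single out `RDS(I)` among the triples `(f₀, f₁, p)`. -/
structure IsRDS (s : CI × CI × unitInterval) : Prop where
  homeo₀ : IsHomeomorph s.1.toMap
  homeo₁ : IsHomeomorph s.2.1.toMap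
  below : ∀ x : OpenI, s.1.onOpen x < x
  above : ∀ x : OpenI, x < s.2.1.onOpen x
  prob : s.2.2 ∈ Ioo (0 : unitInterval) 1
  lyapunov_zero : 0 < lyapunov s 0
  lyapunov_one : 0 < lyapunov s 1

/-- The space `RDS(I)`, as a subspace of the metric space `C(I) × C(I) × [0, 1]` whose distance
is the maximum of the distances of the components. -/
abbrev RDS : Type := {s : CI × CI × unitInterval // IsRDS s}

namespace RDS

/-- The map below the diagonal. -/
def f₀ (f : RDS) : CI := f.1.1

/-- The map above the diagonal. -/
def f₁ (f : RDS) : CI := f.1.2.1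

/-- The probability of choosing `f₀`. -/
def p (f : RDS) : unitInterval := f.1.2.2

/-- The metric on `RDS(I)` is the maximal metric. -/
lemma dist_eq_max (f g : RDS) :
    dist f g = max (distCI f.f₀ g.f₀) (max (distCI f.f₁ g.f₁) |(f.p : ℝ) - g.p|) := rfl

/-- The Markov operator `μ ↦ p • (f₀)_* μ + (1 - p) • (f₁)_* μ` on measures on `(0, 1)`. -/
noncomputable def markov (f : RDS) (μ : Measure OpenI) : Measure OpenI :=
  ENNReal.ofReal f.p • μ.map f.f₀.onOpen + ENNReal.ofReal (1 - f.p) • μ.map f.f₁.onOpen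

/-- Stationary measures of `f` on `(0, 1)`. -/
def IsStationary (f : RDS) (μ : Measure OpenI) : Prop := f.markov μ = μ

/-- `f` has a unique stationary probability measure on `(0, 1)`, and that measure is singular
with respect to Lebesgue measure, has full support (every non-empty open subset of `(0, 1)` has
positive measure) and is atomless. -/
def IsTypical (f : RDS) : Prop :=
  ∃ μ : ProbabilityMeasure OpenI,
    f.IsStationary μ ∧ (∀ ν : ProbabilityMeasure OpenI, f.IsStationary ν → ν = μ) ∧
    (μ : Measure OpenI).MutuallySingular lebesgue ∧
    (∀ U : Set OpenI, IsOpen U → U.Nonempty → 0 < (μ : Measure OpenI) U) ∧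
    ∀ x : OpenI, (μ : Measure OpenI) {x} = 0

end RDS

end IntervalRDS

open IntervalRDS

namespace IntervalRDS

/-! ### The logarithmic coordinate -/

/-! Everything is read on the line through `h`. There an element of $C(I)$ becomes a continuous map
$F:\mathbb R\to\mathbb R$ whose displacement $F(y)-y$ has limits $\log f'(0)$ at $-\infty$ and
$-\log f'(1)$ at $+\infty$, and the metric becomes the sup distance. Hence $C(I)$ is isometric to a
closed set of bounded continuous functions (`CI.isClosed_range_disp`), so it is complete. The
conditions defining $\mathrm{RDS}(I)$ cut out a $G_\delta$ (`isGδ_isRDS`), which is therefore Baire.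

A stationary measure corresponds to a distribution function fixed by $T\psi=p\,\psi\circ
F_0^{-1}+(1-p)\,\psi\circ F_1^{-1}$. Uniqueness comes from a maximum principle
(`RDS.nonpos_of_le_transfer`): an upper semicontinuous $D\le TD$ vanishing at both ends is
nonpositive, because $F_1^{-1}$ moves the leftmost maximum point strictly to the left. For
existence, positive Lyapunov exponents make $e^{\delta y}$ near $-\infty$ and $e^{-\delta y}$ near
$+\infty$ superharmonic, with constants valid for all systems near a given one. These give barriers
$lo\le T\,lo$ and $T\,hi\le hi$ (`RDS.exists_barriers`). The iterates of $lo$ increase, those of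
$hi$ decrease, and the maximum principle identifies the two limits. The common limit is continuous,
so there are no atoms. Being locally both a supremum and an infimum of functions continuous in the
system, it depends continuously on the system (`RDS.continuous_statCDF`).

Singularity is then a countable intersection of the open conditions `RDS.nearlySingular`, and full
support (strict monotonicity of the distribution function) is a countable intersection of open
conditions at rational points. Both kinds of set are dense. For full support, the displacements are
frozen near $-\infty$ to translations of irrational ratio: a flat piece of the distribution function
would then spread to $-\infty$ (`RDS.strictMono_statCDF_of_translations`). For near singularity, the
system is conjugated by a homeomorphism close to the identity and to a staircase, which carries most
of the stationary mass into a neighbourhood of a finite set (`RDS.exists_concentrating`). Baire's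
theorem concludes. -/

/-- The inverse of the coordinate `h`. -/
noncomputable def hInv (y : ℝ) : ℝ :=
  if y ≤ 0 then Real.exp y / 2 else 1 - Real.exp (-y) / 2

lemma hInv_mem (y : ℝ) : hInv y ∈ Ioo (0 : ℝ) 1 := by
  unfold hInv
  split_ifs with hy
  · have := Real.exp_le_one_iff.2 hy
    exact ⟨by positivity, by linarith⟩
  · have := Real.exp_le_one_iff.2 (by linarith : -y ≤ 0)
    have := Real.exp_pos (-y)
    exact ⟨by linarith, by linarith⟩

lemma log_half : Real.log (1 / 2) = -Real.log 2 := by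
  rw [one_div, Real.log_inv]

lemma h_of_le {x : ℝ} (hx : x ≤ 1 / 2) : h x = Real.log x + Real.log 2 := by
  rw [h, if_pos hx, log_half]; ring

lemma h_of_ge {x : ℝ} (hx : 1 / 2 ≤ x) : h x = -Real.log (1 - x) - Real.log 2 := by
  rcases hx.eq_or_lt with rfl | hx
  · rw [h, if_pos le_rfl]
    norm_num [log_half]
  · rw [h, if_neg (not_le.2 hx), log_half]; ring

lemma hInv_of_nonpos {y : ℝ} (hy : y ≤ 0) : hInv y = Real.exp y / 2 := if_pos hy

lemma hInv_of_nonneg {y : ℝ} (hy : 0 ≤ y) : hInv y = 1 - Real.exp (-y) / 2 := by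
  rcases hy.eq_or_lt with rfl | hy
  · norm_num [hInv]
  · exact if_neg (not_le.2 hy)

lemma h_hInv (y : ℝ) : h (hInv y) = y := by
  rcases le_total y 0 with hy | hy
  · have := Real.exp_le_one_iff.2 hy
    rw [hInv_of_nonpos hy, h_of_le (by linarith),
      Real.log_div (Real.exp_pos _).ne' two_ne_zero, Real.log_exp]
    ring
  · have := Real.exp_le_one_iff.2 (by linarith : -y ≤ 0)
    rw [hInv_of_nonneg hy, h_of_ge (by linarith), sub_sub_cancel,
      Real.log_div (Real.exp_pos _).ne' two_ne_zero, Real.log_exp]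
    ring

lemma h_strictMonoOn : StrictMonoOn h (Ioo 0 1) := by
  intro x hx y hy hxy
  have hl2 := Real.log_pos (one_lt_two (α := ℝ))
  rcases le_total x (1 / 2) with h1 | h1 <;> rcases le_total y (1 / 2) with h2 | h2
  · rw [h_of_le h1, h_of_le h2]
    linarith [Real.log_lt_log hx.1 hxy]
  · rw [h_of_le h1, h_of_ge h2]
    have a1 := Real.log_le_log hx.1 h1
    have a2 := Real.log_le_log (by linarith [hy.2] : 0 < 1 - y) (by linarith : 1 - y ≤ 1 / 2)
    rw [log_half] at a1 a2
    rcases h1.lt_or_eq with h3 | h3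
    · have := Real.log_lt_log hx.1 h3
      rw [log_half] at this
      linarith
    · have := Real.log_lt_log (by linarith [hy.2] : 0 < 1 - y) (by linarith : 1 - y < 1 / 2)
      rw [log_half] at this
      linarith
  · linarith
  · rw [h_of_ge h1, h_of_ge h2]
    linarith [Real.log_lt_log (by linarith [hy.2] : 0 < 1 - y) (by linarith : 1 - y < 1 - x)]

/-- The coordinate `h` as an order isomorphism of `(0, 1)` with `ℝ`. -/
noncomputable def H : OpenI ≃o ℝ :=
  StrictMono.orderIsoOfRightInverse (fun x : OpenI => h x)
    (fun x y hxy => h_strictMonoOn x.2 y.2 hxy) (fun y => ⟨hInv y, hInv_mem y⟩) h_hInv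

lemma H_symm_apply (y : ℝ) : (H.symm y : ℝ) = hInv y := rfl

lemma H_lt_iff {x : OpenI} {y : ℝ} : H x < y ↔ x < H.symm y := by
  rw [← H.lt_iff_lt, H.apply_symm_apply]

lemma continuous_H : Continuous H := H.continuous

lemma continuous_H_symm : Continuous H.symm := H.symm.continuous

lemma hInv_H (x : OpenI) : hInv (H x) = x := by
  rw [← H_symm_apply, H.symm_apply_apply]

lemma continuous_hInv : Continuous hInv :=
  continuous_subtype_val.comp continuous_H_symm

lemma tendsto_hInv_atBot : Tendsto hInv atBot (𝓝[>] 0) := by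
  refine tendsto_nhdsWithin_iff.2 ⟨?_, Eventually.of_forall fun y => (hInv_mem y).1⟩
  have : Tendsto (fun y => Real.exp y / 2) atBot (𝓝 0) := by
    simpa using Real.tendsto_exp_atBot.div_const 2
  refine this.congr' ?_
  filter_upwards [eventually_le_atBot 0] with y hy
  rw [hInv_of_nonpos hy]

lemma tendsto_one_sub_hInv_atTop : Tendsto (fun y => 1 - hInv y) atTop (𝓝[>] 0) := by
  refine tendsto_nhdsWithin_iff.2
    ⟨?_, Eventually.of_forall fun y => sub_pos.2 (hInv_mem y).2⟩
  have : Tendsto (fun y => Real.exp (-y) / 2) atTop (𝓝 0) := by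
    simpa using (Real.tendsto_exp_atBot.comp tendsto_neg_atTop_atBot).div_const 2
  refine this.congr' ?_
  filter_upwards [eventually_ge_atTop 0] with y hy
  rw [hInv_of_nonneg hy]; ring

lemma tendsto_h_nhdsGT : Tendsto h (𝓝[>] 0) atBot := by
  have : Tendsto (fun x => Real.log x + Real.log 2) (𝓝[>] 0) atBot :=
    tendsto_atBot_add_const_right _ _ (Real.tendsto_log_nhdsGT_zero)
  refine this.congr' ?_
  filter_upwards [Ioo_mem_nhdsGT (show (0 : ℝ) < 1 / 2 by norm_num)] with x hx
  rw [h_of_le hx.2.le]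

lemma tendsto_h_one_sub : Tendsto (fun x => h (1 - x)) (𝓝[>] 0) atTop := by
  have : Tendsto (fun x => -Real.log x - Real.log 2) (𝓝[>] 0) atTop :=
    tendsto_atTop_add_const_right _ _
      (tendsto_neg_atBot_atTop.comp Real.tendsto_log_nhdsGT_zero)
  refine this.congr' ?_
  filter_upwards [Ioo_mem_nhdsGT (show (0 : ℝ) < 1 / 2 by norm_num)] with x hx
  rw [h_of_ge (by linarith [hx.2]), sub_sub_cancel]

/-! ### Maps in the logarithmic coordinate -/

namespace CI

/-- A map in `C(I)`, read in the coordinate `h`. -/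
noncomputable def coord (f : CI) (y : ℝ) : ℝ := H (f.onOpen (H.symm y))

lemma H_onOpen (f : CI) (x : OpenI) : H (f.onOpen x) = f.coord (H x) := by
  rw [coord, H.symm_apply_apply]

lemma continuous_onOpen (f : CI) : Continuous f.onOpen :=
  ((continuous_subtype_val.comp f.toMap.continuous).comp
    (continuous_subtype_val.subtype_mk _)).subtype_mk _

lemma continuous_coord (f : CI) : Continuous f.coord :=
  continuous_H.comp (f.continuous_onOpen.comp continuous_H_symm)

lemma realExt_hInv (f : CI) (y : ℝ) : realExt f.toMap (hInv y) = hInv (f.coord y) := by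
  rw [← H_symm_apply, f.realExt_open, ← H_symm_apply, coord, H.symm_apply_apply]

lemma dh_eq (f g : CI) (x : OpenI) :
    dh (f.onOpen x) (g.onOpen x) = |f.coord (H x) - g.coord (H x)| := by
  rw [← f.H_onOpen, ← g.H_onOpen]; rfl

lemma abs_coord_sub_le (f g : CI) (y : ℝ) : |f.coord y - g.coord y| ≤ dist f g := by
  have := le_ciSup (distCI_bddAbove f g) (H.symm y)
  rwa [dh_eq, H.apply_symm_apply] at this

lemma dist_le_of_coord {f g : CI} {r : ℝ} (hr : ∀ y, |f.coord y - g.coord y| ≤ r) :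
    dist f g ≤ r := by
  have : Nonempty OpenI := ⟨H.symm 0⟩
  exact ciSup_le fun x => (dh_eq f g x).le.trans (hr _)

lemma tendsto_realExt_div (f : CI) :
    Tendsto (fun x => realExt f.toMap x / x) (𝓝[>] 0) (𝓝 (derivI f.toMap 0)) := by
  have h1 := (hasDerivWithinAt_iff_tendsto_slope.1 f.diff_zero.hasDerivWithinAt).mono_left
    (nhdsWithin_mono (0 : ℝ) (s := Ioo 0 1) fun x hx => ⟨⟨hx.1.le, hx.2.le⟩, hx.1.ne'⟩)
  rw [nhdsWithin_Ioo_eq_nhdsGT one_pos] at h1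
  refine h1.congr fun x => ?_
  simp [slope_def_field, f.realExt_zero]

lemma tendsto_one_sub_realExt_div (f : CI) :
    Tendsto (fun x => (1 - realExt f.toMap (1 - x)) / x) (𝓝[>] 0)
      (𝓝 (derivI f.toMap 1)) := by
  have h1 := (hasDerivWithinAt_iff_tendsto_slope.1 f.diff_one.hasDerivWithinAt).mono_left
    (nhdsWithin_mono (1 : ℝ) (s := Ioo 0 1) fun x hx => ⟨⟨hx.1.le, hx.2.le⟩, hx.2.ne⟩)
  rw [nhdsWithin_Ioo_eq_nhdsLT one_pos] at h1
  have h2 : Tendsto (fun x : ℝ => 1 - x) (𝓝[>] 0) (𝓝[<] 1) := by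
    refine tendsto_nhdsWithin_iff.2 ⟨?_, ?_⟩
    · have : Tendsto (fun x : ℝ => 1 - x) (𝓝 0) (𝓝 (1 - 0)) :=
        tendsto_const_nhds.sub tendsto_id
      rw [sub_zero] at this
      exact this.mono_left nhdsWithin_le_nhds
    · filter_upwards [self_mem_nhdsWithin] with x hx
      have : (0 : ℝ) < x := hx
      simpa using this
  refine (h1.comp h2).congr fun x => ?_
  simp only [Function.comp, slope_def_field, f.realExt_one]
  rw [sub_sub_cancel_left, ← neg_sub, neg_div_neg_eq]

lemma tendsto_coord_atBot (f : CI) : Tendsto f.coord atBot atBot := by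
  have h1 : Tendsto (realExt f.toMap) (𝓝[>] 0) (𝓝[>] 0) := by
    refine tendsto_nhdsWithin_iff.2 ⟨?_, ?_⟩
    · have := (continuous_realExt f.toMap).tendsto 0
      rw [f.realExt_zero] at this
      exact this.mono_left nhdsWithin_le_nhds
    · filter_upwards [Ioo_mem_nhdsGT (one_pos (α := ℝ))] with x hx
      rw [f.realExt_open ⟨x, hx⟩]
      exact (f.onOpen _).2.1
  refine (tendsto_h_nhdsGT.comp (h1.comp tendsto_hInv_atBot)).congr fun y => ?_
  simp only [Function.comp, realExt_hInv, h_hInv]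

lemma tendsto_coord_atTop (f : CI) : Tendsto f.coord atTop atTop := by
  have h1 : Tendsto (fun y => 1 - hInv (f.coord y)) atTop (𝓝[>] 0) := by
    refine tendsto_nhdsWithin_iff.2 ⟨?_, Eventually.of_forall fun y =>
      sub_pos.2 (hInv_mem _).2⟩
    have h2 := tendsto_one_sub_hInv_atTop.mono_right nhdsWithin_le_nhds
    have h3 : Tendsto hInv atTop (𝓝 1) := by
      simpa using tendsto_const_nhds (x := (1 : ℝ)).sub h2
    have := ((continuous_realExt f.toMap).tendsto 1).comp h3
    rw [f.realExt_one] at this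
    simpa [Function.comp_def, realExt_hInv] using tendsto_const_nhds (x := (1 : ℝ)).sub this
  refine (tendsto_h_one_sub.comp h1).congr fun y => ?_
  simp only [Function.comp, sub_sub_cancel, h_hInv]

/-- At `-∞` the displacement converges to the logarithm of the derivative at `0`. -/
lemma tendsto_disp_atBot (f : CI) :
    Tendsto (fun y => f.coord y - y) atBot (𝓝 (Real.log (derivI f.toMap 0))) := by
  have h1 := (Real.continuousAt_log f.deriv_zero_pos.ne').tendsto.comp
    (f.tendsto_realExt_div.comp tendsto_hInv_atBot)
  refine h1.congr' ?_
  filter_upwards [eventually_le_atBot 0, f.tendsto_coord_atBot.eventually_le_atBot 0]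
    with y hy hy'
  simp only [Function.comp, realExt_hInv]
  rw [hInv_of_nonpos hy, hInv_of_nonpos hy', div_div_div_cancel_right₀ two_ne_zero, ← Real.exp_sub, Real.log_exp]

/-- At `+∞` the displacement converges to minus the logarithm of the derivative at `1`. -/
lemma tendsto_disp_atTop (f : CI) :
    Tendsto (fun y => f.coord y - y) atTop (𝓝 (-Real.log (derivI f.toMap 1))) := by
  have h1 := ((Real.continuousAt_log f.deriv_one_pos.ne').tendsto.comp
    (f.tendsto_one_sub_realExt_div.comp tendsto_one_sub_hInv_atTop)).neg
  refine h1.congr' ?_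
  filter_upwards [eventually_ge_atTop 0, f.tendsto_coord_atTop.eventually_ge_atTop 0]
    with y hy hy'
  simp only [Function.comp, sub_sub_cancel, realExt_hInv]
  rw [hInv_of_nonneg hy, hInv_of_nonneg hy', sub_sub_cancel, sub_sub_cancel, div_div_div_cancel_right₀ two_ne_zero, ← Real.exp_sub, Real.log_exp]
  ring

/-! ### Maps with a prescribed coordinate expression -/

/-- The real function that reads `F` in the coordinate `h` on `(0, 1)`. -/
noncomputable def ofCoordFun (F : ℝ → ℝ) (x : ℝ) : ℝ :=
  if x ≤ 0 then 0 else if 1 ≤ x then 1 else hInv (F (h x))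

lemma ofCoordFun_zero (F : ℝ → ℝ) : ofCoordFun F 0 = 0 := if_pos le_rfl

lemma ofCoordFun_one (F : ℝ → ℝ) : ofCoordFun F 1 = 1 := by
  rw [ofCoordFun, if_neg (by norm_num), if_pos le_rfl]

lemma ofCoordFun_Ioo (F : ℝ → ℝ) {x : ℝ} (hx : x ∈ Ioo (0 : ℝ) 1) :
    ofCoordFun F x = hInv (F (h x)) := by
  rw [ofCoordFun, if_neg (not_le.2 hx.1), if_neg (not_le.2 hx.2)]

lemma ofCoordFun_mem (F : ℝ → ℝ) (x : ℝ) : ofCoordFun F x ∈ Icc (0 : ℝ) 1 := by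
  unfold ofCoordFun
  split_ifs
  · simp
  · simp
  · exact ⟨(hInv_mem _).1.le, (hInv_mem _).2.le⟩

/-- Since `hInv` is `exp y / 2` on the negative half-line, the difference quotient at `0` is exactly
the exponential of the displacement as soon as `h x` and `F (h x)` are both nonpositive. -/
lemma hasDerivWithinAt_ofCoordFun_zero {F : ℝ → ℝ} {a : ℝ}
    (ha : Tendsto (fun y => F y - y) atBot (𝓝 a)) :
    HasDerivWithinAt (ofCoordFun F) (Real.exp a) (Icc 0 1) 0 := by
  rw [hasDerivWithinAt_iff_tendsto_slope]
  have hs : Icc (0 : ℝ) 1 \ {0} = Ioc 0 1 := Icc_sdiff_left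
  rw [hs, nhdsWithin_Ioc_eq_nhdsGT one_pos]
  have hF : Tendsto F atBot atBot :=
    (ha.add_atBot tendsto_id).congr fun y => sub_add_cancel _ _
  have h1 : Tendsto (fun x => Real.exp (F (h x) - h x)) (𝓝[>] 0) (𝓝 (Real.exp a)) :=
    (Real.continuous_exp.tendsto a).comp (ha.comp tendsto_h_nhdsGT)
  refine h1.congr' ?_
  filter_upwards [Ioo_mem_nhdsGT (one_pos (α := ℝ)),
    tendsto_h_nhdsGT.eventually_le_atBot 0,
    tendsto_h_nhdsGT.eventually (hF.eventually_le_atBot 0)] with x hx h2 h3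
  rw [slope_def_field, ofCoordFun_zero, ofCoordFun_Ioo F hx, sub_zero, sub_zero]
  have h4 : x = hInv (h x) := (hInv_H ⟨x, hx⟩).symm
  conv_rhs => rw [h4, h_hInv]
  rw [hInv_of_nonpos h2, hInv_of_nonpos h3, div_div_div_cancel_right₀ two_ne_zero,
    ← Real.exp_sub]

lemma hasDerivWithinAt_ofCoordFun_one {F : ℝ → ℝ} {b : ℝ}
    (hb : Tendsto (fun y => F y - y) atTop (𝓝 b)) :
    HasDerivWithinAt (ofCoordFun F) (Real.exp (-b)) (Icc 0 1) 1 := by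
  rw [hasDerivWithinAt_iff_tendsto_slope]
  have hs : Icc (0 : ℝ) 1 \ {1} = Ico 0 1 := Icc_sdiff_right
  rw [hs, nhdsWithin_Ico_eq_nhdsLT one_pos]
  have hF : Tendsto F atTop atTop :=
    (hb.add_atTop tendsto_id).congr fun y => sub_add_cancel _ _
  have hh : Tendsto h (𝓝[<] 1) atTop := by
    have h2 : Tendsto (fun x : ℝ => 1 - x) (𝓝[<] 1) (𝓝[>] 0) := by
      refine tendsto_nhdsWithin_iff.2 ⟨?_, ?_⟩
      · have : Tendsto (fun x : ℝ => 1 - x) (𝓝 1) (𝓝 (1 - 1)) :=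
          tendsto_const_nhds.sub tendsto_id
        rw [sub_self] at this
        exact this.mono_left nhdsWithin_le_nhds
      · filter_upwards [self_mem_nhdsWithin] with x hx
        exact sub_pos.2 (mem_Iio.1 hx)
    simpa [Function.comp_def] using tendsto_h_one_sub.comp h2
  have h1 : Tendsto (fun x => Real.exp (-(F (h x) - h x))) (𝓝[<] 1) (𝓝 (Real.exp (-b))) :=
    (Real.continuous_exp.tendsto (-b)).comp (hb.comp hh).neg
  refine h1.congr' ?_
  filter_upwards [Ioo_mem_nhdsLT (zero_lt_one (α := ℝ)), hh.eventually_ge_atTop 0,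
    hh.eventually (hF.eventually_ge_atTop 0)] with x hx h2 h3
  rw [slope_def_field, ofCoordFun_one, ofCoordFun_Ioo F hx]
  have h4 : x = hInv (h x) := (hInv_H ⟨x, hx⟩).symm
  conv_rhs => rw [h4, h_hInv]
  rw [hInv_of_nonneg h2, hInv_of_nonneg h3, sub_sub_cancel_left, sub_sub_cancel_left,
    neg_div_neg_eq, div_div_div_cancel_right₀ two_ne_zero, ← Real.exp_sub]
  congr 1; ring

lemma continuousOn_ofCoordFun {F : ℝ → ℝ} {a b : ℝ} (hF : Continuous F)
    (ha : Tendsto (fun y => F y - y) atBot (𝓝 a))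
    (hb : Tendsto (fun y => F y - y) atTop (𝓝 b)) :
    ContinuousOn (ofCoordFun F) (Icc 0 1) := by
  intro x hx
  rcases hx.1.eq_or_lt with rfl | h0
  · exact (hasDerivWithinAt_ofCoordFun_zero ha).continuousWithinAt
  rcases hx.2.eq_or_lt with rfl | h1
  · exact (hasDerivWithinAt_ofCoordFun_one hb).continuousWithinAt
  have hc : ContinuousOn (fun x => hInv (F (h x))) (Ioo 0 1) := by
    rw [continuousOn_iff_continuous_domRestrict]
    exact continuous_hInv.comp (hF.comp continuous_H)
  have hn : Ioo (0 : ℝ) 1 ∈ 𝓝 x := isOpen_Ioo.mem_nhds ⟨h0, h1⟩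
  refine ((hc.continuousAt hn).congr ?_).continuousWithinAt
  filter_upwards [hn] with z hz
  rw [ofCoordFun_Ioo F hz]

lemma eqOn_realExt_ofCoordFun {F : ℝ → ℝ} {m : C(unitInterval, unitInterval)}
    (hm : ∀ x, (m x : ℝ) = ofCoordFun F x) : EqOn (realExt m) (ofCoordFun F) (Icc 0 1) :=
  fun x hx => by rw [realExt_apply _ _ hx, hm]

lemma hasDerivWithinAt_realExt_zero {F : ℝ → ℝ} {m : C(unitInterval, unitInterval)} {a : ℝ}
    (hm : ∀ x, (m x : ℝ) = ofCoordFun F x) (ha : Tendsto (fun y => F y - y) atBot (𝓝 a)) :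
    HasDerivWithinAt (realExt m) (Real.exp a) (Icc 0 1) 0 :=
  (hasDerivWithinAt_ofCoordFun_zero ha).congr_of_mem (eqOn_realExt_ofCoordFun hm) (by simp)

lemma hasDerivWithinAt_realExt_one {F : ℝ → ℝ} {m : C(unitInterval, unitInterval)} {b : ℝ}
    (hm : ∀ x, (m x : ℝ) = ofCoordFun F x) (hb : Tendsto (fun y => F y - y) atTop (𝓝 b)) :
    HasDerivWithinAt (realExt m) (Real.exp (-b)) (Icc 0 1) 1 :=
  (hasDerivWithinAt_ofCoordFun_one hb).congr_of_mem (eqOn_realExt_ofCoordFun hm) (by simp)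

/-- A continuous map of the line whose displacement converges at both ends is the coordinate
expression of a map in `C(I)`. -/
lemma exists_coord_eq {F : ℝ → ℝ} {a b : ℝ} (hF : Continuous F)
    (ha : Tendsto (fun y => F y - y) atBot (𝓝 a))
    (hb : Tendsto (fun y => F y - y) atTop (𝓝 b)) : ∃ f : CI, f.coord = F := by
  obtain ⟨m, hm⟩ : ∃ m : C(unitInterval, unitInterval), ∀ x, (m x : ℝ) = ofCoordFun F x :=
    ⟨⟨fun x => ⟨ofCoordFun F x, ofCoordFun_mem F x⟩,
      ((continuousOn_ofCoordFun hF ha hb).domRestrict).subtype_mk _⟩, fun _ => rfl⟩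
  have m0 : m 0 = 0 := Subtype.ext ((hm 0).trans (ofCoordFun_zero F))
  have m1 : m 1 = 1 := Subtype.ext ((hm 1).trans (ofCoordFun_one F))
  have d0 := hasDerivWithinAt_realExt_zero hm ha
  have d1 := hasDerivWithinAt_realExt_one hm hb
  have hu : UniqueDiffOn ℝ (Icc (0 : ℝ) 1) := uniqueDiffOn_Icc_zero_one
  refine ⟨⟨m, ?_, m0, m1, ?_, d0.differentiableWithinAt, d1.differentiableWithinAt, ?_, ?_⟩, ?_⟩
  · intro y
    have := intermediate_value_univ (0 : unitInterval) 1 m.continuous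
    rw [m0, m1] at this
    exact this ⟨y.2.1, y.2.2⟩
  · intro x hx
    have : (m x : ℝ) = hInv (F (h x)) := (hm x).trans (ofCoordFun_Ioo F ⟨hx.1, hx.2⟩)
    refine ⟨?_, ?_⟩
    · change (0 : ℝ) < m x
      rw [this]; exact (hInv_mem _).1
    · change (m x : ℝ) < 1
      rw [this]; exact (hInv_mem _).2
  · have : derivI m 0 = Real.exp a := d0.derivWithin (hu 0 (by simp))
    rw [this]; exact Real.exp_pos _
  · have : derivI m 1 = Real.exp (-b) := d1.derivWithin (hu 1 (by simp))
    rw [this]; exact Real.exp_pos _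
  · funext y
    rw [coord, ← H.apply_symm_apply (F y)]
    congr 1
    refine Subtype.ext ((hm _).trans ?_)
    rw [ofCoordFun_Ioo F (H.symm y).2, H_symm_apply, h_hInv]
    rfl

lemma surjective_coord (f : CI) : Function.Surjective f.coord :=
  f.continuous_coord.surjective f.tendsto_coord_atTop f.tendsto_coord_atBot

/-- A map in `C(I)` is a homeomorphism iff its coordinate expression is strictly increasing. -/
lemma isHomeomorph_iff (f : CI) : IsHomeomorph f.toMap ↔ StrictMono f.coord := by
  constructor
  · intro hf
    have hm : StrictMono f.toMap := by
      refine f.toMap.continuous.strictMono_of_inj_boundedOrder ?_ hf.injective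
      change f.toMap 0 ≤ f.toMap 1
      rw [f.map_zero, f.map_one]
      exact zero_le_one
    intro y z hyz
    refine H.strictMono ?_
    exact hm (show (⟨H.symm y, _⟩ : unitInterval) < ⟨H.symm z, _⟩ from H.symm.strictMono hyz)
  · intro hf
    have ho : StrictMono f.onOpen := by
      intro x y hxy
      rw [← H.lt_iff_lt, f.H_onOpen, f.H_onOpen]
      exact hf (H.strictMono hxy)
    have hinj : Function.Injective f.toMap := by
      refine StrictMono.injective fun x y hxy => ?_
      rcases x.2.1.eq_or_lt with h0 | h0
      · have hx : x = 0 := Subtype.ext h0.symm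
        rcases y.2.2.eq_or_lt with h1 | h1
        · have hy : y = 1 := Subtype.ext h1
          rw [hx, hy, f.map_zero, f.map_one]; exact zero_lt_one
        · rw [hx, f.map_zero]
          exact (f.map_Ioo y ⟨hx ▸ hxy, h1⟩).1
      · rcases y.2.2.eq_or_lt with h1 | h1
        · have hy : y = 1 := Subtype.ext h1
          rw [hy, f.map_one]
          exact (f.map_Ioo x ⟨h0, hy ▸ hxy⟩).2
        · exact ho (show (⟨x, h0, lt_trans hxy h1⟩ : OpenI) < ⟨y, lt_trans h0 hxy, h1⟩ from hxy)
    exact isHomeomorph_iff_continuous_bijective.2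
      ⟨f.toMap.continuous, hinj, f.surj⟩

end CI

/-! ### Completeness of `C(I)` -/

/-- The Cauchy criterion transfers from a uniformly close function, so the limits of the
approximants never have to be compared with one another. -/
lemma exists_tendsto_of_forall_uniform_approx {u : ℝ → ℝ} {l : Filter ℝ} [l.NeBot]
    (hu : ∀ ε > 0, ∃ (g : ℝ → ℝ) (a : ℝ), Tendsto g l (𝓝 a) ∧ ∀ y, |u y - g y| ≤ ε) :
    ∃ a, Tendsto u l (𝓝 a) := by
  rw [← cauchy_map_iff_exists_tendsto, Metric.cauchy_iff]
  refine ⟨inferInstance, fun ε hε => ?_⟩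
  obtain ⟨g, a, hg, hug⟩ := hu (ε / 5) (by positivity)
  refine ⟨u '' {y | dist (g y) a < ε / 5},
    image_mem_map (hg.eventually (Metric.ball_mem_nhds a (by positivity))), ?_⟩
  rintro _ ⟨x, hx, rfl⟩ _ ⟨y, hy, rfl⟩
  have hx' : |g x - a| < ε / 5 := hx
  have hy' : |g y - a| < ε / 5 := hy
  have h1 := abs_le.1 (hug x)
  have h2 := abs_le.1 (hug y)
  rw [abs_lt] at hx' hy'
  rw [Real.dist_eq, abs_lt]
  constructor <;> linarith

namespace CI

/-- The displacement of a map in `C(I)` in the coordinate `h`. -/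
noncomputable def disp (f : CI) : BoundedContinuousFunction ℝ ℝ :=
  BoundedContinuousFunction.ofNormedAddCommGroup (fun y => f.coord y - y)
    (f.continuous_coord.sub continuous_id) f.dh_self_bounded.choose (fun y => by
      have h1 := f.dh_self_bounded.choose_spec (H.symm y)
      have h2 : dh (f.onOpen (H.symm y)) (H.symm y) = |f.coord y - y| := by
        conv_rhs => rw [← H.apply_symm_apply y]
        rw [← f.H_onOpen]; rfl
      rwa [h2] at h1)

lemma disp_apply (f : CI) (y : ℝ) : f.disp y = f.coord y - y := rfl

lemma isometry_disp : Isometry disp := by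
  refine Isometry.of_dist_eq fun f g => le_antisymm ?_ ?_
  · refine (BoundedContinuousFunction.dist_le dist_nonneg).2 fun y => ?_
    rw [Real.dist_eq, disp_apply, disp_apply, sub_sub_sub_cancel_right]
    exact abs_coord_sub_le f g y
  · refine dist_le_of_coord fun y => ?_
    have := BoundedContinuousFunction.dist_coe_le_dist (f := f.disp) (g := g.disp) y
    rwa [Real.dist_eq, disp_apply, disp_apply, sub_sub_sub_cancel_right] at this

/-- Uniform limits of displacements still converge at both ends, and by `exists_coord_eq` a
continuous displacement has to satisfy nothing else. -/
lemma isClosed_range_disp : IsClosed (range disp) := by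
  refine isClosed_of_closure_subset fun u hu => ?_
  rw [Metric.mem_closure_range_iff] at hu
  have happ : ∀ ε > 0, ∃ f : CI, ∀ y, |u y - f.disp y| ≤ ε := by
    intro ε hε
    obtain ⟨f, hf⟩ := hu ε hε
    exact ⟨f, fun y => (BoundedContinuousFunction.dist_coe_le_dist y).trans hf.le⟩
  obtain ⟨a, ha⟩ := exists_tendsto_of_forall_uniform_approx (u := u) (l := atBot)
    fun ε hε => (happ ε hε).elim fun f hf => ⟨f.disp, _, f.tendsto_disp_atBot, hf⟩
  obtain ⟨b, hb⟩ := exists_tendsto_of_forall_uniform_approx (u := u) (l := atTop)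
    fun ε hε => (happ ε hε).elim fun f hf => ⟨f.disp, _, f.tendsto_disp_atTop, hf⟩
  obtain ⟨f, hf⟩ := exists_coord_eq (F := fun y => u y + y) (a := a) (b := b)
    (u.continuous.add continuous_id) (by simpa using ha) (by simpa using hb)
  refine ⟨f, ?_⟩
  ext y
  rw [disp_apply, hf, add_sub_cancel_right]

instance : CompleteSpace CI :=
  (completeSpace_iff_isComplete_range isometry_disp.isUniformInducing).2
    isClosed_range_disp.isComplete

/-! ### Continuous dependence of the coordinate expression on the map -/

lemma lipschitzWith_coord (y : ℝ) : LipschitzWith 1 fun f : CI => f.coord y :=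
  LipschitzWith.mk_one fun f g => by
    rw [Real.dist_eq]; exact abs_coord_sub_le f g y

lemma continuous_uncurry_coord : Continuous fun z : CI × ℝ => z.1.coord z.2 :=
  continuous_prod_of_continuous_lipschitzWith _ 1 continuous_coord lipschitzWith_coord

/-- The logarithm of the derivative is the limit of the displacement, and a limit is 1-Lipschitz for
the sup distance. This makes the Lyapunov exponents continuous. -/
lemma continuous_log_derivI_zero : Continuous fun f : CI => Real.log (derivI f.toMap 0) := by
  refine (LipschitzWith.of_dist_le' (K := 1) fun f g => ?_).continuous
  rw [one_mul, Real.dist_eq]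
  refine le_of_tendsto (f.tendsto_disp_atBot.sub g.tendsto_disp_atBot).abs
    (Eventually.of_forall fun y => ?_)
  rw [sub_sub_sub_cancel_right]
  exact abs_coord_sub_le f g y

lemma continuous_log_derivI_one : Continuous fun f : CI => Real.log (derivI f.toMap 1) := by
  refine (LipschitzWith.of_dist_le' (K := 1) fun f g => ?_).continuous
  rw [one_mul, Real.dist_eq]
  have h1 := (f.tendsto_disp_atTop.sub g.tendsto_disp_atTop).abs
  rw [neg_sub_neg, abs_sub_comm] at h1
  refine le_of_tendsto h1 (Eventually.of_forall fun y => ?_)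
  rw [sub_sub_sub_cancel_right]
  exact abs_coord_sub_le f g y

/-! ### The conditions defining `RDS(I)` as `G_δ` conditions -/

/-- The maps that are homeomorphisms form a `G_δ` set. -/
lemma isGδ_isHomeomorph : IsGδ {f : CI | IsHomeomorph f.toMap} := by
  -- Monotonicity is a closed condition; given it, strictness need only be tested on pairs of
  -- rationals, where it is open.
  have h1 : {f : CI | IsHomeomorph f.toMap} =
      {f | Monotone f.coord} ∩
        ⋂ q : ℚ, ⋂ r : ℚ, {f | q < r → f.coord q < f.coord r} := by
    ext f
    simp only [mem_ofPred_eq, isHomeomorph_iff, mem_inter_iff, mem_iInter]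
    refine ⟨fun hf => ⟨hf.monotone, fun q r hqr => hf (by exact_mod_cast hqr)⟩, ?_⟩
    rintro ⟨hm, hq⟩ x y hxy
    obtain ⟨q, hxq, hqy⟩ := exists_rat_btwn hxy
    obtain ⟨r, hqr, hry⟩ := exists_rat_btwn hqy
    calc f.coord x ≤ f.coord q := hm hxq.le
      _ < f.coord r := hq q r (by exact_mod_cast hqr)
      _ ≤ f.coord y := hm hry.le
  rw [h1]
  refine IsGδ.inter (IsClosed.isGδ ?_) (.iInter fun q => .iInter fun r => IsOpen.isGδ ?_)
  · have : {f : CI | Monotone f.coord} =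
        ⋂ x : ℝ, ⋂ y : ℝ, ⋂ _ : x ≤ y, {f | f.coord x ≤ f.coord y} := by
      ext f; simp [Monotone]
    rw [this]
    exact isClosed_iInter fun x => isClosed_iInter fun y => isClosed_iInter fun _ =>
      isClosed_le (lipschitzWith_coord x).continuous (lipschitzWith_coord y).continuous
  · by_cases hqr : q < r
    · simpa [hqr] using isOpen_lt (lipschitzWith_coord q).continuous
        (lipschitzWith_coord r).continuous
    · simp [hqr]

lemma below_iff (f : CI) : (∀ x, f.onOpen x < x) ↔ ∀ y, f.coord y < y := by
  refine ⟨fun hf y => ?_, fun hf x => ?_⟩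
  · rw [coord, H_lt_iff]; exact hf _
  · rw [← H.lt_iff_lt, f.H_onOpen]; exact hf _

lemma above_iff (f : CI) : (∀ x, x < f.onOpen x) ↔ ∀ y, y < f.coord y := by
  refine ⟨fun hf y => ?_, fun hf x => ?_⟩
  · rw [coord, ← H.symm.lt_iff_lt, H.symm_apply_apply]; exact hf _
  · rw [← H.lt_iff_lt, f.H_onOpen]; exact hf _

/-- Over a compact interval of points the condition is open by the tube lemma. Exhausting the line
by such intervals gives a countable intersection. -/
lemma isGδ_forall_of_isOpen {P : CI → ℝ → Prop} (hP : IsOpen {z : CI × ℝ | P z.1 z.2}) :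
    IsGδ {f : CI | ∀ y, P f y} := by
  have : {f : CI | ∀ y, P f y} = ⋂ n : ℕ, {f | ∀ y ∈ Icc (-n : ℝ) n, P f y} := by
    ext f
    simp only [mem_ofPred_eq, mem_iInter]
    refine ⟨fun hf n y _ => hf y, fun hf y => ?_⟩
    obtain ⟨n, hn⟩ := exists_nat_ge |y|
    exact hf n y (abs_le.1 hn)
  rw [this]
  refine .iInter fun n => IsOpen.isGδ (isOpen_iff_mem_nhds.2 fun f hf => ?_)
  exact isCompact_Icc.eventually_forall_of_forall_eventually fun y hy =>
    hP.mem_nhds (hf y hy)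

lemma isGδ_below : IsGδ {f : CI | ∀ x, f.onOpen x < x} := by
  simp_rw [below_iff]
  exact isGδ_forall_of_isOpen (isOpen_lt continuous_uncurry_coord continuous_snd)

lemma isGδ_above : IsGδ {f : CI | ∀ x, x < f.onOpen x} := by
  simp_rw [above_iff]
  exact isGδ_forall_of_isOpen (isOpen_lt continuous_snd continuous_uncurry_coord)

end CI

/-! ### `RDS(I)` is a Baire space -/

lemma continuous_lyapunov_zero : Continuous fun s : CI × CI × unitInterval => lyapunov s 0 := by
  unfold lyapunov
  have c1 := CI.continuous_log_derivI_zero.comp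
    (continuous_fst (X := CI) (Y := CI × unitInterval))
  have c2 := CI.continuous_log_derivI_zero.comp
    (continuous_fst.comp (continuous_snd (X := CI) (Y := CI × unitInterval)))
  have c3 : Continuous fun s : CI × CI × unitInterval => (s.2.2 : ℝ) := by fun_prop
  exact (c3.mul c1).add ((continuous_const.sub c3).mul c2)

lemma continuous_lyapunov_one : Continuous fun s : CI × CI × unitInterval => lyapunov s 1 := by
  unfold lyapunov
  have c1 := CI.continuous_log_derivI_one.comp
    (continuous_fst (X := CI) (Y := CI × unitInterval))
  have c2 := CI.continuous_log_derivI_one.comp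
    (continuous_fst.comp (continuous_snd (X := CI) (Y := CI × unitInterval)))
  have c3 : Continuous fun s : CI × CI × unitInterval => (s.2.2 : ℝ) := by fun_prop
  exact (c3.mul c1).add ((continuous_const.sub c3).mul c2)

lemma _root_.IsGδ.preimage_of_continuous {X Y : Type*} [TopologicalSpace X]
    [TopologicalSpace Y] {g : X → Y} {s : Set Y} (hs : IsGδ s) (hg : Continuous g) :
    IsGδ (g ⁻¹' s) := by
  obtain ⟨V, hV, rfl⟩ := isGδ_iff_eq_iInter_nat.1 hs
  rw [preimage_iInter]
  exact .iInter fun n => ((hV n).preimage hg).isGδ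

lemma isGδ_isRDS : IsGδ {s : CI × CI × unitInterval | IsRDS s} := by
  have h1 : {s : CI × CI × unitInterval | IsRDS s} =
      (Prod.fst ⁻¹' {f : CI | IsHomeomorph f.toMap} ∩
        (fun s => s.2.1) ⁻¹' {f : CI | IsHomeomorph f.toMap}) ∩
      (Prod.fst ⁻¹' {f : CI | ∀ x, f.onOpen x < x} ∩
        (fun s => s.2.1) ⁻¹' {f : CI | ∀ x, x < f.onOpen x}) ∩
      ((fun s => s.2.2) ⁻¹' Ioo 0 1 ∩ {s | 0 < lyapunov s 0} ∩ {s | 0 < lyapunov s 1}) := by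
    ext s
    exact ⟨fun hs => ⟨⟨⟨hs.1, hs.2⟩, hs.3, hs.4⟩, ⟨hs.5, hs.6⟩, hs.7⟩,
      fun hs => ⟨hs.1.1.1, hs.1.1.2, hs.1.2.1, hs.1.2.2, hs.2.1.1, hs.2.1.2, hs.2.2⟩⟩
  rw [h1]
  have c2 : Continuous fun s : CI × CI × unitInterval => s.2.1 := by fun_prop
  have c3 : Continuous fun s : CI × CI × unitInterval => s.2.2 := by fun_prop
  refine ((IsGδ.inter ?_ ?_).inter (IsGδ.inter ?_ ?_)).inter (IsOpen.isGδ ?_)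
  · exact CI.isGδ_isHomeomorph.preimage_of_continuous continuous_fst
  · exact CI.isGδ_isHomeomorph.preimage_of_continuous c2
  · exact CI.isGδ_below.preimage_of_continuous continuous_fst
  · exact CI.isGδ_above.preimage_of_continuous c2
  · exact ((isOpen_Ioo.preimage c3).inter
      (isOpen_lt continuous_const continuous_lyapunov_zero)).inter
      (isOpen_lt continuous_const continuous_lyapunov_one)

/-- A `G_δ` subset of a complete metric space is a Baire space. -/
lemma _root_.IsGδ.baireSpace_of_completeSpace {X : Type*} [MetricSpace X] [CompleteSpace X]
    {s : Set X} (hs : IsGδ s) : BaireSpace s := by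
  -- In its closure, which is complete, `s` is a dense `G_δ`.
  have : CompleteSpace (closure s) := isClosed_closure.completeSpace_coe
  have hG : IsGδ ((↑) ⁻¹' s : Set (closure s)) :=
    hs.preimage_of_continuous continuous_subtype_val
  have hd : Dense ((↑) ⁻¹' s : Set (closure s)) := by
    intro x
    rw [closure_subtype, Subtype.image_preimage_coe, inter_eq_self_of_subset_right subset_closure]
    exact x.2
  have := hG.baireSpace_of_dense hd
  let e : ((↑) ⁻¹' s : Set (closure s)) ≃ₜ s :=
    { toFun := fun x => ⟨x.1.1, x.2⟩
      invFun := fun x => ⟨⟨x.1, subset_closure x.2⟩, x.2⟩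
      left_inv := fun _ => rfl
      right_inv := fun _ => rfl
      continuous_toFun :=
        (continuous_subtype_val.comp continuous_subtype_val).subtype_mk _
      continuous_invFun := (continuous_subtype_val.subtype_mk _).subtype_mk _ }
  exact e.baireSpace

instance : BaireSpace RDS := isGδ_isRDS.baireSpace_of_completeSpace

/-! ### Inverse maps, the transfer operator and the maximum principle -/

/-- The inverses of a continuous family of increasing functions depend continuously on the
parameter and the point. -/
lemma continuous_uncurry_inverse {X : Type*} [TopologicalSpace X] {G I : X → ℝ → ℝ}
    (hG : ∀ y, Continuous fun x => G x y) (hI : ∀ x y z, I x y < z ↔ y < G x z)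
    (hI' : ∀ x y z, z < I x y ↔ G x z < y) : Continuous fun z : X × ℝ => I z.1 z.2 := by
  refine continuous_iff_continuousAt.2 fun ⟨x, y⟩ => tendsto_order.2 ⟨fun a ha => ?_, fun a ha => ?_⟩
  · have h1 : IsOpen {z : X × ℝ | G z.1 a < z.2} :=
      isOpen_lt ((hG a).comp continuous_fst) continuous_snd
    filter_upwards [h1.mem_nhds ((hI' x y a).1 ha)] with z hz
    exact (hI' _ _ _).2 hz
  · have h1 : IsOpen {z : X × ℝ | z.2 < G z.1 a} :=
      isOpen_lt continuous_snd ((hG a).comp continuous_fst)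
    filter_upwards [h1.mem_nhds ((hI x y a).1 ha)] with z hz
    exact (hI _ _ _).2 hz

/-- As a function of `δ` the left side equals `1` at `δ = 0` and has there the negative derivative
`p * b₀ + (1 - p) * b₁`. -/
lemma exists_pos_convex_exp_lt_one {p b₀ b₁ : ℝ} (hb : p * b₀ + (1 - p) * b₁ < 0) :
    ∃ δ > 0, p * Real.exp (δ * b₀) + (1 - p) * Real.exp (δ * b₁) < 1 := by
  have hd : ∀ b : ℝ, HasDerivAt (fun δ : ℝ => Real.exp (δ * b)) b 0 := fun b => by
    simpa using ((hasDerivAt_id (0 : ℝ)).mul_const b).exp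
  have h1 := ((hd b₀).const_mul p).add ((hd b₁).const_mul (1 - p))
  have h2 := ((hasDerivAt_iff_tendsto_slope.1 h1).mono_left
    (nhdsWithin_mono (0 : ℝ) (s := Ioi 0) fun x hx => (ne_of_gt (mem_Ioi.1 hx) : x ≠ 0))).eventually_lt_const hb
  obtain ⟨δ, h3, hδ⟩ := (h2.and (self_mem_nhdsWithin (s := Ioi (0 : ℝ)))).exists
  have hδ : 0 < δ := hδ
  refine ⟨δ, hδ, ?_⟩
  rw [slope_def_field, sub_zero, div_lt_iff₀ hδ, zero_mul] at h3
  simp at h3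
  linarith

namespace RDS

variable (f : RDS)

lemma strictMono_coord₀ : StrictMono f.f₀.coord := (CI.isHomeomorph_iff _).1 f.2.homeo₀

lemma strictMono_coord₁ : StrictMono f.f₁.coord := (CI.isHomeomorph_iff _).1 f.2.homeo₁

lemma coord₀_lt (y : ℝ) : f.f₀.coord y < y := (CI.below_iff _).1 f.2.below y

lemma lt_coord₁ (y : ℝ) : y < f.f₁.coord y := (CI.above_iff _).1 f.2.above y

lemma p_pos : 0 < (f.p : ℝ) := f.2.prob.1

lemma p_lt_one : (f.p : ℝ) < 1 := f.2.prob.2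

lemma one_sub_p_pos : 0 < 1 - (f.p : ℝ) := sub_pos.2 f.p_lt_one

/-- The inverse of `f₀` in the coordinate `h`. -/
noncomputable def inv₀ : ℝ ≃o ℝ :=
  (StrictMono.orderIsoOfSurjective _ f.strictMono_coord₀ f.f₀.surjective_coord).symm

/-- The inverse of `f₁` in the coordinate `h`. -/
noncomputable def inv₁ : ℝ ≃o ℝ :=
  (StrictMono.orderIsoOfSurjective _ f.strictMono_coord₁ f.f₁.surjective_coord).symm

lemma coord₀_inv₀ (y : ℝ) : f.f₀.coord (f.inv₀ y) = y := f.inv₀.symm_apply_apply y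

lemma inv₀_coord₀ (y : ℝ) : f.inv₀ (f.f₀.coord y) = y := f.inv₀.apply_symm_apply y

lemma coord₁_inv₁ (y : ℝ) : f.f₁.coord (f.inv₁ y) = y := f.inv₁.symm_apply_apply y

lemma inv₁_coord₁ (y : ℝ) : f.inv₁ (f.f₁.coord y) = y := f.inv₁.apply_symm_apply y

lemma inv₀_le_iff {y z : ℝ} : f.inv₀ y ≤ z ↔ y ≤ f.f₀.coord z := by
  rw [← f.strictMono_coord₀.le_iff_le, coord₀_inv₀]

lemma le_inv₀_iff {y z : ℝ} : z ≤ f.inv₀ y ↔ f.f₀.coord z ≤ y := by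
  rw [← f.strictMono_coord₀.le_iff_le, coord₀_inv₀]

lemma inv₁_le_iff {y z : ℝ} : f.inv₁ y ≤ z ↔ y ≤ f.f₁.coord z := by
  rw [← f.strictMono_coord₁.le_iff_le, coord₁_inv₁]

lemma le_inv₁_iff {y z : ℝ} : z ≤ f.inv₁ y ↔ f.f₁.coord z ≤ y := by
  rw [← f.strictMono_coord₁.le_iff_le, coord₁_inv₁]

lemma lt_inv₀ (y : ℝ) : y < f.inv₀ y := by
  rw [← f.strictMono_coord₀.lt_iff_lt, coord₀_inv₀]; exact f.coord₀_lt y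

lemma inv₁_lt (y : ℝ) : f.inv₁ y < y := by
  rw [← f.strictMono_coord₁.lt_iff_lt, coord₁_inv₁]; exact f.lt_coord₁ y

lemma continuous_f₀ : Continuous f₀ := continuous_fst.comp continuous_subtype_val

lemma continuous_f₁ : Continuous f₁ :=
  (continuous_fst.comp continuous_snd).comp continuous_subtype_val

lemma continuous_p : Continuous fun f : RDS => (f.p : ℝ) :=
  continuous_subtype_val.comp ((continuous_snd.comp continuous_snd).comp continuous_subtype_val)

lemma continuous_uncurry_inv₀ : Continuous fun z : RDS × ℝ => z.1.inv₀ z.2 :=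
  continuous_uncurry_inverse (G := fun f : RDS => f.f₀.coord) (I := fun f => f.inv₀)
    (fun y => (CI.lipschitzWith_coord y).continuous.comp continuous_f₀)
    (fun f y z => by rw [← not_le, le_inv₀_iff, not_le])
    (fun f y z => by rw [← not_le, inv₀_le_iff, not_le])

lemma continuous_uncurry_inv₁ : Continuous fun z : RDS × ℝ => z.1.inv₁ z.2 :=
  continuous_uncurry_inverse (G := fun f : RDS => f.f₁.coord) (I := fun f => f.inv₁)
    (fun y => (CI.lipschitzWith_coord y).continuous.comp continuous_f₁)
    (fun f y z => by rw [← not_le, le_inv₁_iff, not_le])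
    (fun f y z => by rw [← not_le, inv₁_le_iff, not_le])

/-- The action of the Markov operator on distribution functions, in the coordinate `h`. -/
noncomputable def transfer (ψ : ℝ → ℝ) (y : ℝ) : ℝ :=
  f.p * ψ (f.inv₀ y) + (1 - f.p) * ψ (f.inv₁ y)

lemma transfer_mono : Monotone f.transfer := fun _ _ h _ =>
  add_le_add (mul_le_mul_of_nonneg_left (h _) f.p_pos.le)
    (mul_le_mul_of_nonneg_left (h _) f.one_sub_p_pos.le)

lemma monotone_transfer {ψ : ℝ → ℝ} (hψ : Monotone ψ) : Monotone (f.transfer ψ) :=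
  fun _ _ h => add_le_add
    (mul_le_mul_of_nonneg_left (hψ (f.inv₀.monotone h)) f.p_pos.le)
    (mul_le_mul_of_nonneg_left (hψ (f.inv₁.monotone h)) f.one_sub_p_pos.le)

lemma transfer_const (c y : ℝ) : f.transfer (fun _ => c) y = c := by
  unfold transfer; ring

lemma transfer_sub (ψ χ : ℝ → ℝ) (y : ℝ) :
    f.transfer (fun z => ψ z - χ z) y = f.transfer ψ y - f.transfer χ y := by
  unfold transfer; ring

lemma transfer_const_mul (c : ℝ) (ψ : ℝ → ℝ) (y : ℝ) :
    f.transfer (fun z => c * ψ z) y = c * f.transfer ψ y := by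
  unfold transfer; ring

lemma tendsto_transfer {a : ℕ → ℝ → ℝ} {φ : ℝ → ℝ}
    (ha : ∀ y, Tendsto (fun n => a n y) atTop (𝓝 (φ y))) (y : ℝ) :
    Tendsto (fun n => f.transfer (a n) y) atTop (𝓝 (f.transfer φ y)) :=
  ((ha _).const_mul _).add ((ha _).const_mul _)

lemma continuous_uncurry_iterate_transfer {ψ : ℝ → ℝ} (hψ : Continuous ψ) (n : ℕ) :
    Continuous fun z : RDS × ℝ => z.1.transfer^[n] ψ z.2 := by
  induction n with
  | zero => exact hψ.comp continuous_snd
  | succ n ih =>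
    simp only [Function.iterate_succ_apply']
    have hp : Continuous fun z : RDS × ℝ => (z.1.p : ℝ) := continuous_p.comp continuous_fst
    exact (hp.mul (ih.comp (continuous_fst.prodMk continuous_uncurry_inv₀))).add
      ((continuous_const.sub hp).mul (ih.comp (continuous_fst.prodMk continuous_uncurry_inv₁)))

/-- The maximum principle for the transfer operator. -/
lemma nonpos_of_le_transfer {D : ℝ → ℝ} (hD : UpperSemicontinuous D)
    (hbot : Tendsto D atBot (𝓝 0)) (htop : Tendsto D atTop (𝓝 0))
    (hle : ∀ y, D y ≤ f.transfer D y) (y : ℝ) : D y ≤ 0 := by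
  by_contra! hy
  obtain ⟨a, ha⟩ := eventually_atBot.1 (hbot.eventually_lt_const hy)
  obtain ⟨b, hb⟩ := eventually_atTop.1 (htop.eventually_lt_const hy)
  have hay : a < y := not_le.1 fun h => (ha y h).false
  have hyb : y < b := not_le.1 fun h => (hb y h).false
  obtain ⟨m, hm, hmax⟩ := (hD.upperSemicontinuousOn (Icc a b)).exists_isMaxOn
    (nonempty_Icc.2 (hay.trans hyb).le) isCompact_Icc
  have hmy : D y ≤ D m := hmax ⟨hay.le, hyb.le⟩
  have hglob : ∀ z, D z ≤ D m := by
    intro z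
    by_cases hz : z ∈ Icc a b
    · exact hmax hz
    · rw [mem_Icc, not_and_or, not_le, not_le] at hz
      rcases hz with hz | hz
      · exact (ha z hz.le).le.trans hmy
      · exact (hb z hz.le).le.trans hmy
  -- `A` is the set of maximum points, closed by upper semicontinuity. At its least element the
  -- point `f.inv₁ (sInf A)` lies further left, outside `A`, so the average on the right of `hle` is
  -- strictly below the maximum.
  set A : Set ℝ := D ⁻¹' Ici (D m) with hA
  have hAne : A.Nonempty := ⟨m, le_refl (D m)⟩
  have hAbdd : BddBelow A := ⟨a, fun z hz => (not_le.1 fun h =>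
    ((ha z h).trans_le hmy).not_ge hz).le⟩
  have hinf : sInf A ∈ A := (hD.isClosed_preimage (D m)).csInf_mem hAne hAbdd
  have h1 : D (f.inv₁ (sInf A)) < D m := by
    refine lt_of_not_ge fun h => ?_
    exact (csInf_le hAbdd (show f.inv₁ (sInf A) ∈ A from h)).not_gt (f.inv₁_lt _)
  have h2 := mul_lt_mul_of_pos_left h1 f.one_sub_p_pos
  have h3 := mul_le_mul_of_nonneg_left (hglob (f.inv₀ (sInf A))) f.p_pos.le
  have h4 := hle (sInf A)
  have h5 : D m ≤ D (sInf A) := hinf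
  unfold transfer at h4
  linarith

/-! ### Barriers -/

lemma eventually_dist_f₀_lt {ε : ℝ} (hε : 0 < ε) : ∀ᶠ g : RDS in 𝓝 f, dist g.f₀ f.f₀ < ε :=
  continuous_f₀.continuousAt.eventually (Metric.ball_mem_nhds _ hε)

lemma eventually_dist_f₁_lt {ε : ℝ} (hε : 0 < ε) : ∀ᶠ g : RDS in 𝓝 f, dist g.f₁ f.f₁ < ε :=
  continuous_f₁.continuousAt.eventually (Metric.ball_mem_nhds _ hε)

lemma eventually_convex_lt_one {c₀ c₁ : ℝ} (hc : f.p * c₀ + (1 - f.p) * c₁ < 1) :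
    ∀ᶠ g : RDS in 𝓝 f, g.p * c₀ + (1 - g.p) * c₁ < 1 :=
  (((continuous_p.mul continuous_const).add
    ((continuous_const.sub continuous_p).mul continuous_const)).tendsto f).eventually_lt_const hc

/-- Near $-\infty$ the inverses are almost translations by $-a_0$ and $-a_1$, with mean $-l<0$. Of
the slack $l/2$ granted to each shift, $l/4$ pays for the distance of the displacement of `f` from
its limit and $l/4$ for the distance from `f` to `g`. The mean remains $-l/2<0$, so a small exponent
`δ` works. -/
lemma exists_superharmonic_atBot : ∃ δ > 0, ∃ R ≥ 0, ∀ᶠ g : RDS in 𝓝 f, ∀ y ≤ -R,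
    g.transfer (fun z => Real.exp (δ * z)) y ≤ Real.exp (δ * y) := by
  set a₀ := Real.log (derivI f.f₀.toMap 0)
  set a₁ := Real.log (derivI f.f₁.toMap 0)
  set l := f.p * a₀ + (1 - f.p) * a₁ with hl
  have hlpos : 0 < l := f.2.lyapunov_zero
  obtain ⟨δ, hδ, hlt⟩ := exists_pos_convex_exp_lt_one (p := f.p) (b₀ := l / 2 - a₀)
    (b₁ := l / 2 - a₁) (by linarith)
  obtain ⟨Z₀, hZ₀⟩ := eventually_atBot.1 (f.f₀.tendsto_disp_atBot.eventually_const_lt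
    (show a₀ - l / 4 < a₀ by linarith))
  obtain ⟨Z₁, hZ₁⟩ := eventually_atBot.1 (f.f₁.tendsto_disp_atBot.eventually_const_lt
    (show a₁ - l / 4 < a₁ by linarith))
  refine ⟨δ, hδ, max 0 (max (l / 2 - a₀ - Z₀) (l / 2 - a₁ - Z₁)), le_max_left _ _, ?_⟩
  filter_upwards [f.eventually_dist_f₀_lt (show 0 < l / 4 by linarith),
    f.eventually_dist_f₁_lt (show 0 < l / 4 by linarith),
    f.eventually_convex_lt_one hlt] with g hg₀ hg₁ hgp y hy
  have hR₁ := (le_max_left (l / 2 - a₀ - Z₀) (l / 2 - a₁ - Z₁)).trans (le_max_right 0 _)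
  have hR₂ := (le_max_right (l / 2 - a₀ - Z₀) (l / 2 - a₁ - Z₁)).trans (le_max_right 0 _)
  have h₀ : g.inv₀ y ≤ y + (l / 2 - a₀) := by
    rw [inv₀_le_iff]
    have h1 := hZ₀ (y + (l / 2 - a₀)) (by linarith)
    have h2 := abs_le.1 ((CI.abs_coord_sub_le g.f₀ f.f₀ (y + (l / 2 - a₀))).trans hg₀.le)
    linarith [h2.1]
  have h₁ : g.inv₁ y ≤ y + (l / 2 - a₁) := by
    rw [inv₁_le_iff]
    have h1 := hZ₁ (y + (l / 2 - a₁)) (by linarith)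
    have h2 := abs_le.1 ((CI.abs_coord_sub_le g.f₁ f.f₁ (y + (l / 2 - a₁))).trans hg₁.le)
    linarith [h2.1]
  calc g.transfer (fun z => Real.exp (δ * z)) y
      ≤ g.p * Real.exp (δ * (y + (l / 2 - a₀))) +
          (1 - g.p) * Real.exp (δ * (y + (l / 2 - a₁))) :=
        add_le_add
          (mul_le_mul_of_nonneg_left
            (Real.exp_le_exp.2 (mul_le_mul_of_nonneg_left h₀ hδ.le)) g.p_pos.le)
          (mul_le_mul_of_nonneg_left
            (Real.exp_le_exp.2 (mul_le_mul_of_nonneg_left h₁ hδ.le)) g.one_sub_p_pos.le)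
    _ = Real.exp (δ * y) * (g.p * Real.exp (δ * (l / 2 - a₀)) +
          (1 - g.p) * Real.exp (δ * (l / 2 - a₁))) := by
        rw [mul_add, mul_add, Real.exp_add, Real.exp_add]; ring
    _ ≤ Real.exp (δ * y) * 1 := mul_le_mul_of_nonneg_left hgp.le (Real.exp_pos _).le
    _ = Real.exp (δ * y) := mul_one _

lemma exists_superharmonic_atTop : ∃ δ > 0, ∃ R ≥ 0, ∀ᶠ g : RDS in 𝓝 f, ∀ y ≥ R,
    g.transfer (fun z => Real.exp (-(δ * z))) y ≤ Real.exp (-(δ * y)) := by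
  set a₀ := Real.log (derivI f.f₀.toMap 1)
  set a₁ := Real.log (derivI f.f₁.toMap 1)
  set l := f.p * a₀ + (1 - f.p) * a₁ with hl
  have hlpos : 0 < l := f.2.lyapunov_one
  obtain ⟨δ, hδ, hlt⟩ := exists_pos_convex_exp_lt_one (p := f.p) (b₀ := l / 2 - a₀)
    (b₁ := l / 2 - a₁) (by linarith)
  obtain ⟨Z₀, hZ₀⟩ := eventually_atTop.1 (f.f₀.tendsto_disp_atTop.eventually_lt_const
    (show -a₀ < -a₀ + l / 4 by linarith))
  obtain ⟨Z₁, hZ₁⟩ := eventually_atTop.1 (f.f₁.tendsto_disp_atTop.eventually_lt_const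
    (show -a₁ < -a₁ + l / 4 by linarith))
  -- The bound is chosen so that `y - (l / 2 - a₀)` and `y - (l / 2 - a₁)` stay beyond `Z₀` and
  -- `Z₁`, where the displacement estimates hold.
  refine ⟨δ, hδ, max 0 (max (l / 2 - a₀ + Z₀) (l / 2 - a₁ + Z₁)), le_max_left _ _, ?_⟩
  filter_upwards [f.eventually_dist_f₀_lt (show 0 < l / 4 by linarith),
    f.eventually_dist_f₁_lt (show 0 < l / 4 by linarith),
    f.eventually_convex_lt_one hlt] with g hg₀ hg₁ hgp y hy
  have hR₁ := (le_max_left (l / 2 - a₀ + Z₀) (l / 2 - a₁ + Z₁)).trans (le_max_right 0 _)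
  have hR₂ := (le_max_right (l / 2 - a₀ + Z₀) (l / 2 - a₁ + Z₁)).trans (le_max_right 0 _)
  have h₀ : y - (l / 2 - a₀) ≤ g.inv₀ y := by
    rw [le_inv₀_iff]
    have h1 := hZ₀ (y - (l / 2 - a₀)) (by linarith)
    have h2 := abs_le.1 ((CI.abs_coord_sub_le g.f₀ f.f₀ (y - (l / 2 - a₀))).trans hg₀.le)
    linarith [h2.2]
  have h₁ : y - (l / 2 - a₁) ≤ g.inv₁ y := by
    rw [le_inv₁_iff]
    have h1 := hZ₁ (y - (l / 2 - a₁)) (by linarith)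
    have h2 := abs_le.1 ((CI.abs_coord_sub_le g.f₁ f.f₁ (y - (l / 2 - a₁))).trans hg₁.le)
    linarith [h2.2]
  calc g.transfer (fun z => Real.exp (-(δ * z))) y
      ≤ g.p * Real.exp (-(δ * (y - (l / 2 - a₀)))) +
          (1 - g.p) * Real.exp (-(δ * (y - (l / 2 - a₁)))) :=
        add_le_add
          (mul_le_mul_of_nonneg_left
            (Real.exp_le_exp.2 (neg_le_neg (mul_le_mul_of_nonneg_left h₀ hδ.le))) g.p_pos.le)
          (mul_le_mul_of_nonneg_left
            (Real.exp_le_exp.2 (neg_le_neg (mul_le_mul_of_nonneg_left h₁ hδ.le)))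
            g.one_sub_p_pos.le)
    _ = Real.exp (-(δ * y)) * (g.p * Real.exp (δ * (l / 2 - a₀)) +
          (1 - g.p) * Real.exp (δ * (l / 2 - a₁))) := by
        have e : ∀ b, -(δ * (y - b)) = -(δ * y) + δ * b := fun b => by ring
        rw [e, e, Real.exp_add, Real.exp_add]
        ring
    _ ≤ Real.exp (-(δ * y)) * 1 := mul_le_mul_of_nonneg_left hgp.le (Real.exp_pos _).le
    _ = Real.exp (-(δ * y)) := mul_one _

/-- Monotone functions from `0` to `1` that are sub- and superharmonic for all systems
near `f`. -/
lemma exists_barriers : ∃ lo hi : ℝ → ℝ, Continuous lo ∧ Continuous hi ∧ Monotone lo ∧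
    lo ≤ hi ∧ Tendsto lo atBot (𝓝 0) ∧ Tendsto hi atBot (𝓝 0) ∧ Tendsto lo atTop (𝓝 1) ∧
    Tendsto hi atTop (𝓝 1) ∧
    ∀ᶠ g : RDS in 𝓝 f, lo ≤ g.transfer lo ∧ g.transfer hi ≤ hi := by
  obtain ⟨δ, hδ, R, hR, h1⟩ := f.exists_superharmonic_atBot
  obtain ⟨η, hη, S, hS, h2⟩ := f.exists_superharmonic_atTop
  have e1 : ∀ y, -R ≤ y → 1 ≤ Real.exp (δ * R) * Real.exp (δ * y) := fun y hy => by
    rw [← Real.exp_add, ← mul_add]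
    exact Real.one_le_exp (mul_nonneg hδ.le (by linarith))
  have e2 : ∀ y, y ≤ S → 1 ≤ Real.exp (η * S) * Real.exp (-(η * y)) := fun y hy => by
    rw [← Real.exp_add, ← sub_eq_add_neg, ← mul_sub]
    exact Real.one_le_exp (mul_nonneg hη.le (by linarith))
  have t1 : Tendsto (fun y => Real.exp (δ * R) * Real.exp (δ * y)) atBot (𝓝 0) := by
    simpa using (Real.tendsto_exp_atBot.comp
      ((tendsto_const_mul_atBot_of_pos hδ).2 tendsto_id)).const_mul (Real.exp (δ * R))
  have t2 : Tendsto (fun y => 1 - Real.exp (η * S) * Real.exp (-(η * y))) atTop (𝓝 1) := by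
    simpa using ((Real.tendsto_exp_atBot.comp (tendsto_neg_atTop_atBot.comp
      ((tendsto_const_mul_atTop_of_pos hη).2 tendsto_id))).const_mul
        (Real.exp (η * S))).const_sub 1
  -- The prefactors make the first function vanish on `y ≤ S` and the second equal `1` on `y ≥ -R`,
  -- so the exponential estimates are needed only where they are available. As `-R ≤ 0 ≤ S`, at each
  -- point one of the two functions is at its constant value, which gives `lo ≤ hi`.
  refine ⟨fun y => max 0 (1 - Real.exp (η * S) * Real.exp (-(η * y))),
    fun y => min 1 (Real.exp (δ * R) * Real.exp (δ * y)), by fun_prop, by fun_prop, ?_, ?_,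
    ?_, ?_, ?_, ?_, ?_⟩
  · intro x y hxy
    refine max_le_max le_rfl (sub_le_sub_left (mul_le_mul_of_nonneg_left
      (Real.exp_le_exp.2 (neg_le_neg (mul_le_mul_of_nonneg_left hxy hη.le)))
      (Real.exp_pos _).le) _)
  · intro y
    have := Real.exp_pos (η * S)
    have := Real.exp_pos (-(η * y))
    refine max_le (le_min zero_le_one (by positivity)) (le_min ?_ ?_)
    · linarith [mul_pos (Real.exp_pos (η * S)) (Real.exp_pos (-(η * y)))]
    · rcases le_total (-R) y with hy | hy
      · linarith [e1 y hy, mul_pos (Real.exp_pos (η * S)) (Real.exp_pos (-(η * y)))]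
      · linarith [e2 y (by linarith), mul_pos (Real.exp_pos (δ * R)) (Real.exp_pos (δ * y))]
  · refine tendsto_const_nhds.congr' ?_
    filter_upwards [eventually_le_atBot S] with y hy
    exact (max_eq_left (by linarith [e2 y hy])).symm
  · simpa using (tendsto_const_nhds (x := (1 : ℝ))).min t1
  · simpa using (tendsto_const_nhds (x := (0 : ℝ))).max t2
  · refine tendsto_const_nhds.congr' ?_
    filter_upwards [eventually_ge_atTop (-R)] with y hy
    exact (min_eq_left (e1 y hy)).symm
  · filter_upwards [h1, h2] with g hg1 hg2
    refine ⟨fun y => max_le ?_ ?_, fun y => le_min ?_ ?_⟩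
    · refine (g.transfer_const 0 y).ge.trans (g.transfer_mono (fun z => le_max_left _ _) y)
    · rcases le_total S y with hy | hy
      · refine le_trans ?_ (g.transfer_mono (fun z => le_max_right _ _) y)
        rw [transfer_sub, transfer_const, transfer_const_mul]
        exact sub_le_sub_left (mul_le_mul_of_nonneg_left (hg2 y hy) (Real.exp_pos _).le) _
      · refine le_trans (by linarith [e2 y hy]) ((g.transfer_const 0 y).ge.trans
          (g.transfer_mono (fun z => le_max_left _ _) y))
    · exact (g.transfer_mono (fun z => min_le_left _ _) y).trans (g.transfer_const 1 y).le
    · rcases le_total y (-R) with hy | hy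
      · refine (g.transfer_mono (fun z => min_le_right _ _) y).trans ?_
        rw [transfer_const_mul]
        exact mul_le_mul_of_nonneg_left (hg1 y hy) (Real.exp_pos _).le
      · exact ((g.transfer_mono (fun z => min_le_left _ _) y).trans
          (g.transfer_const 1 y).le).trans (e1 y hy)

/-! ### The stationary distribution function -/

/-- Continuous distribution functions on the line that are fixed by the transfer operator. -/
structure IsStationaryCDF (φ : ℝ → ℝ) : Prop where
  continuous : Continuous φ
  monotone : Monotone φ
  tendsto_atBot : Tendsto φ atBot (𝓝 0)
  tendsto_atTop : Tendsto φ atTop (𝓝 1)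
  transfer_eq : ∀ y, f.transfer φ y = φ y

variable {f}

lemma IsStationaryCDF.unique {φ ψ : ℝ → ℝ} (hφ : f.IsStationaryCDF φ)
    (hψ : f.IsStationaryCDF ψ) : φ = ψ := by
  have key : ∀ {φ ψ : ℝ → ℝ}, f.IsStationaryCDF φ → f.IsStationaryCDF ψ → φ ≤ ψ := by
    intro φ ψ hφ hψ y
    refine sub_nonpos.1 (f.nonpos_of_le_transfer (D := fun z => φ z - ψ z)
      (hφ.continuous.sub hψ.continuous).upperSemicontinuous ?_ ?_ ?_ y)
    · simpa using hφ.tendsto_atBot.sub hψ.tendsto_atBot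
    · simpa using hφ.tendsto_atTop.sub hψ.tendsto_atTop
    · intro z
      rw [transfer_sub, hφ.transfer_eq, hψ.transfer_eq]
  exact le_antisymm (key hφ hψ) (key hψ hφ)

variable (f)

/-- The increasing iterates of `lo` have a lower semicontinuous limit `L`, the decreasing iterates
of `hi` an upper semicontinuous limit `U ≥ L`, both fixed by the transfer operator. The maximum
principle applied to `U - L`, squeezed to `0` at both ends, gives `U = L`, which is therefore
continuous. The `IsLUB` and `IsGLB` clauses serve continuity in the system. -/
lemma exists_isStationaryCDF_of_barriers {lo hi : ℝ → ℝ} (clo : Continuous lo)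
    (chi : Continuous hi) (mlo : Monotone lo) (hle : lo ≤ hi) (lo0 : Tendsto lo atBot (𝓝 0))
    (hi0 : Tendsto hi atBot (𝓝 0)) (lo1 : Tendsto lo atTop (𝓝 1))
    (hi1 : Tendsto hi atTop (𝓝 1)) (hlo : lo ≤ f.transfer lo) (hhi : f.transfer hi ≤ hi) :
    ∃ φ, f.IsStationaryCDF φ ∧ (∀ y, IsLUB (range fun n => f.transfer^[n] lo y) (φ y)) ∧
      ∀ y, IsGLB (range fun n => f.transfer^[n] hi y) (φ y) := by
  have inc : ∀ y, Monotone fun n => f.transfer^[n] lo y := fun y m n hmn =>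
    f.transfer_mono.monotone_iterate_of_le_map hlo hmn y
  have dec : ∀ y, Antitone fun n => f.transfer^[n] hi y := fun y m n hmn =>
    f.transfer_mono.antitone_iterate_of_map_le hhi hmn y
  have hlh : ∀ n y, f.transfer^[n] lo y ≤ f.transfer^[n] hi y := fun n =>
    f.transfer_mono.iterate n hle
  have cont : ∀ {ψ : ℝ → ℝ}, Continuous ψ → ∀ n, Continuous (f.transfer^[n] ψ) :=
    fun hψ n => (continuous_uncurry_iterate_transfer hψ n).comp (continuous_const.prodMk continuous_id)
  have bddA : ∀ y, BddAbove (range fun n => f.transfer^[n] lo y) := fun y =>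
    ⟨hi y, by rintro _ ⟨n, rfl⟩; exact (hlh n y).trans (dec y (Nat.zero_le n))⟩
  have bddB : ∀ y, BddBelow (range fun n => f.transfer^[n] hi y) := fun y =>
    ⟨lo y, by rintro _ ⟨n, rfl⟩; exact (inc y (Nat.zero_le n)).trans (hlh n y)⟩
  set L : ℝ → ℝ := fun y => ⨆ n, f.transfer^[n] lo y with hL
  set U : ℝ → ℝ := fun y => ⨅ n, f.transfer^[n] hi y with hU
  have tL : ∀ y, Tendsto (fun n => f.transfer^[n] lo y) atTop (𝓝 (L y)) := fun y =>
    tendsto_atTop_ciSup (inc y) (bddA y)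
  have tU : ∀ y, Tendsto (fun n => f.transfer^[n] hi y) atTop (𝓝 (U y)) := fun y =>
    tendsto_atTop_ciInf (dec y) (bddB y)
  have harm : ∀ {ψ φ : ℝ → ℝ},
      (∀ y, Tendsto (fun n => f.transfer^[n] ψ y) atTop (𝓝 (φ y))) →
      ∀ y, f.transfer φ y = φ y := by
    intro ψ φ ht y
    refine tendsto_nhds_unique (f.tendsto_transfer ht y) ?_
    simpa only [Function.comp_def, Function.iterate_succ_apply'] using
      (ht y).comp (tendsto_add_atTop_nat 1)
  have hLU : ∀ y, L y ≤ U y := fun y => le_of_tendsto_of_tendsto' (tL y) (tU y) fun n => hlh n y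
  have loL : ∀ y, lo y ≤ L y := fun y => le_ciSup (bddA y) 0
  have Uhi : ∀ y, U y ≤ hi y := fun y => ciInf_le (bddB y) 0
  have lsc : LowerSemicontinuous L :=
    lowerSemicontinuous_ciSup bddA fun n => (cont clo n).lowerSemicontinuous
  have usc : UpperSemicontinuous U :=
    upperSemicontinuous_ciInf bddB fun n => (cont chi n).upperSemicontinuous
  have hUL : ∀ y, U y ≤ L y := by
    intro y
    have lim : ∀ {l : Filter ℝ} {c : ℝ}, Tendsto lo l (𝓝 c) → Tendsto hi l (𝓝 c) →
        Tendsto (fun z => U z - L z) l (𝓝 0) := by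
      intro l c h1 h2
      refine squeeze_zero (fun z => sub_nonneg.2 (hLU z))
        (fun z => sub_le_sub (Uhi z) (loL z)) ?_
      simpa using h2.sub h1
    have usc' : UpperSemicontinuous fun z => U z - L z := by
      intro z r hr
      have h1 := usc z (U z + (r - (U z - L z)) / 2) (by linarith)
      have h2 := lsc z (L z - (r - (U z - L z)) / 2) (by linarith)
      filter_upwards [h1, h2] with w hw1 hw2
      linarith
    refine sub_nonpos.1 (f.nonpos_of_le_transfer usc' (lim lo0 hi0) (lim lo1 hi1) (fun z => ?_) y)
    rw [transfer_sub, harm tL, harm tU]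
  have hEq : U = L := funext fun y => le_antisymm (hUL y) (hLU y)
  refine ⟨L, ⟨?_, ?_, ?_, ?_, harm tL⟩, fun y => isLUB_ciSup (bddA y), fun y => ?_⟩
  · rw [continuous_iff_lower_upperSemicontinuous]
    exact ⟨lsc, hEq ▸ usc⟩
  · have hmono : ∀ n, Monotone (f.transfer^[n] lo) := by
      intro n
      induction n with
      | zero => exact mlo
      | succ n ih =>
        rw [Function.iterate_succ_apply']
        exact f.monotone_transfer ih
    exact fun x y hxy => ciSup_mono (bddA y) fun n => hmono n hxy
  · exact tendsto_of_tendsto_of_tendsto_of_le_of_le lo0 hi0 loL fun y => (hLU y).trans (Uhi y)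
  · exact tendsto_of_tendsto_of_tendsto_of_le_of_le lo1 hi1 loL fun y => (hLU y).trans (Uhi y)
  · rw [← hEq]
    exact isGLB_ciInf (bddB y)

lemma exists_isStationaryCDF : ∃ φ, f.IsStationaryCDF φ := by
  obtain ⟨lo, hi, h1, h2, h3, h4, h5, h6, h7, h8, h9⟩ := f.exists_barriers
  obtain ⟨φ, hφ, -⟩ := f.exists_isStationaryCDF_of_barriers h1 h2 h3 h4 h5 h6 h7 h8
    h9.self_of_nhds.1 h9.self_of_nhds.2
  exact ⟨φ, hφ⟩

/-- The distribution function of the stationary measure, in the coordinate `h`. -/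
noncomputable def statCDF : ℝ → ℝ := f.exists_isStationaryCDF.choose

lemma isStationaryCDF_statCDF : f.IsStationaryCDF f.statCDF :=
  f.exists_isStationaryCDF.choose_spec

/-- The stationary distribution function depends continuously on the system. -/
lemma continuous_statCDF (y : ℝ) : Continuous fun f : RDS => f.statCDF y := by
  refine continuous_iff_continuousAt.2 fun f => ?_
  obtain ⟨lo, hi, h1, h2, h3, h4, h5, h6, h7, h8, h9⟩ := f.exists_barriers
  -- The same barriers work for all `g` near `f`, so the value at `y` is locally both a supremum and
  -- an infimum of functions continuous in `g`: lower and upper semicontinuity follow.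
  have key : ∀ᶠ g : RDS in 𝓝 f, IsLUB (range fun n => g.transfer^[n] lo y) (g.statCDF y) ∧
      IsGLB (range fun n => g.transfer^[n] hi y) (g.statCDF y) := by
    filter_upwards [h9] with g hg
    obtain ⟨φ, hφ, hL, hU⟩ :=
      g.exists_isStationaryCDF_of_barriers h1 h2 h3 h4 h5 h6 h7 h8 hg.1 hg.2
    rw [g.isStationaryCDF_statCDF.unique hφ]
    exact ⟨hL y, hU y⟩
  have cont : ∀ {ψ : ℝ → ℝ}, Continuous ψ → ∀ n, Continuous fun g : RDS => g.transfer^[n] ψ y :=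
    fun hψ n => (continuous_uncurry_iterate_transfer hψ n).comp
      (continuous_id.prodMk continuous_const)
  refine tendsto_order.2 ⟨fun a ha => ?_, fun a ha => ?_⟩
  · obtain ⟨_, ⟨n, rfl⟩, hn⟩ := (lt_isLUB_iff key.self_of_nhds.1).1 ha
    filter_upwards [key, ((cont h1 n).tendsto f).eventually_const_lt hn] with g hg hn'
    exact hn'.trans_le (hg.1.1 ⟨n, rfl⟩)
  · obtain ⟨_, ⟨n, rfl⟩, hn⟩ := (isGLB_lt_iff key.self_of_nhds.2).1 ha
    filter_upwards [key, ((cont h2 n).tendsto f).eventually_lt_const hn] with g hg hn'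
    exact (hg.2.1 ⟨n, rfl⟩).trans_lt hn'

end RDS

open ProbabilityTheory

/-! ### Stationary measures and distribution functions -/

/-- The coordinate `h` as a measurable equivalence. -/
noncomputable def HMeas : OpenI ≃ᵐ ℝ := H.toHomeomorph.toMeasurableEquiv

lemma H_comp_symm : (H : OpenI → ℝ) ∘ H.symm = id := funext H.apply_symm_apply

lemma H_symm_comp : (H.symm : ℝ → OpenI) ∘ H = id := funext H.symm_apply_apply

lemma measurable_H : Measurable H := HMeas.measurable

lemma map_H_injective {μ ν : Measure OpenI} (hμν : μ.map H = ν.map H) : μ = ν :=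
  MeasurableEquiv.map_measurableEquiv_injective HMeas hμν

instance isProbabilityMeasure_map_H (μ : Measure OpenI) [IsProbabilityMeasure μ] :
    IsProbabilityMeasure (μ.map H) :=
  Measure.isProbabilityMeasure_map measurable_H.aemeasurable

namespace RDS

variable (f : RDS)

lemma preimage_onOpen_f₀ (y : ℝ) :
    f.f₀.onOpen ⁻¹' (H ⁻¹' Iic y) = H ⁻¹' Iic (f.inv₀ y) := by
  ext x
  simp only [mem_preimage, mem_Iic, CI.H_onOpen, le_inv₀_iff]

lemma preimage_onOpen_f₁ (y : ℝ) :
    f.f₁.onOpen ⁻¹' (H ⁻¹' Iic y) = H ⁻¹' Iic (f.inv₁ y) := by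
  ext x
  simp only [mem_preimage, mem_Iic, CI.H_onOpen, le_inv₁_iff]

instance isProbabilityMeasure_markov (μ : Measure OpenI) [IsProbabilityMeasure μ] :
    IsProbabilityMeasure (f.markov μ) := by
  have h0 : IsProbabilityMeasure (μ.map f.f₀.onOpen) :=
    Measure.isProbabilityMeasure_map f.f₀.continuous_onOpen.measurable.aemeasurable
  have h1 : IsProbabilityMeasure (μ.map f.f₁.onOpen) :=
    Measure.isProbabilityMeasure_map f.f₁.continuous_onOpen.measurable.aemeasurable
  constructor
  rw [markov, Measure.add_apply, Measure.smul_apply, Measure.smul_apply, measure_univ,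
    measure_univ, smul_eq_mul, smul_eq_mul, mul_one, mul_one,
    ← ENNReal.ofReal_add f.p_pos.le f.one_sub_p_pos.le, add_sub_cancel, ENNReal.ofReal_one]

lemma cdf_map_markov (μ : Measure OpenI) [IsProbabilityMeasure μ] (y : ℝ) :
    cdf ((f.markov μ).map H) y = f.transfer (cdf (μ.map H)) y := by
  have hm : ∀ z, MeasurableSet (H ⁻¹' Iic z) := fun z => measurable_H measurableSet_Iic
  have e : ∀ z, (μ.map H).real (Iic z) = (μ (H ⁻¹' Iic z)).toReal := fun z => by
    rw [Measure.real, Measure.map_apply measurable_H measurableSet_Iic]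
  rw [transfer, cdf_eq_real, cdf_eq_real, cdf_eq_real, e, e, Measure.real,
    Measure.map_apply measurable_H measurableSet_Iic, markov, Measure.add_apply,
    Measure.smul_apply, Measure.smul_apply,
    Measure.map_apply f.f₀.continuous_onOpen.measurable (hm y),
    Measure.map_apply f.f₁.continuous_onOpen.measurable (hm y),
    preimage_onOpen_f₀, preimage_onOpen_f₁, smul_eq_mul, smul_eq_mul,
    ENNReal.toReal_add (by finiteness) (by finiteness), ENNReal.toReal_mul, ENNReal.toReal_mul,
    ENNReal.toReal_ofReal f.p_pos.le, ENNReal.toReal_ofReal f.one_sub_p_pos.le]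

lemma isStationary_iff (μ : Measure OpenI) [IsProbabilityMeasure μ] :
    f.IsStationary μ ↔ ∀ y, f.transfer (cdf (μ.map H)) y = cdf (μ.map H) y := by
  refine ⟨fun h y => ?_, fun h => map_H_injective (Measure.eq_of_cdf _ _ ?_)⟩
  · rw [← cdf_map_markov, h]
  · ext y
    rw [cdf_map_markov, h]

/-- A distribution function fixed by the transfer operator is the continuous one. -/
lemma _root_.StieltjesFunction.eq_statCDF {Φ : StieltjesFunction ℝ}
    (h0 : Tendsto Φ atBot (𝓝 0)) (h1 : Tendsto Φ atTop (𝓝 1))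
    (hΦ : ∀ y, f.transfer Φ y = Φ y) : (Φ : ℝ → ℝ) = f.statCDF := by
  have hs := f.isStationaryCDF_statCDF
  -- A monotone right-continuous function is upper semicontinuous, which is the regularity the
  -- maximum principle needs.
  have le1 : ∀ y, Φ y ≤ f.statCDF y := by
    refine fun y => sub_nonpos.1 (f.nonpos_of_le_transfer (D := fun z => Φ z - f.statCDF z)
      ?_ ?_ ?_ ?_ y)
    · intro y r hr
      have hr' : ∀ᶠ z in 𝓝[≥] y, Φ z < Φ y + (r - (Φ y - f.statCDF y)) / 2 :=
        (Φ.right_continuous y).eventually_lt_const (by linarith)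
      have hr'' : ∀ᶠ z in 𝓝[≤] y, Φ z < Φ y + (r - (Φ y - f.statCDF y)) / 2 := by
        filter_upwards [self_mem_nhdsWithin] with z hz
        have := Φ.mono (mem_Iic.1 hz)
        linarith
      have h3 : ∀ᶠ z in 𝓝 y, Φ z < Φ y + (r - (Φ y - f.statCDF y)) / 2 := by
        rw [← nhdsLE_sup_nhdsGE]; exact Filter.eventually_sup.2 ⟨hr'', hr'⟩
      filter_upwards [h3, (hs.continuous.tendsto y).eventually_const_lt
        (show f.statCDF y - (r - (Φ y - f.statCDF y)) / 2 < f.statCDF y by linarith)] with z a b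
      linarith
    · simpa using h0.sub hs.tendsto_atBot
    · simpa using h1.sub hs.tendsto_atTop
    · intro z
      rw [transfer_sub, hΦ, hs.transfer_eq]
  have hl : ∀ y, Function.leftLim Φ y ≤ Φ y := fun y => Φ.mono.leftLim_le le_rfl
  have hsand : ∀ y, Φ (y - 1) ≤ Function.leftLim Φ y := fun y =>
    Φ.mono.le_leftLim (by linarith)
  -- For the other inequality `Φ` is replaced by its left limit, which is lower semicontinuous. It
  -- is again fixed by the transfer operator because the inverse maps are increasing homeomorphisms.
  have le2 : ∀ y, f.statCDF y ≤ Function.leftLim Φ y := by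
    refine fun y => sub_nonpos.1 (f.nonpos_of_le_transfer
      (D := fun z => f.statCDF z - Function.leftLim Φ z) ?_ ?_ ?_ ?_ y)
    · intro y r hr
      set d := (r - (f.statCDF y - Function.leftLim Φ y)) / 2 with hd
      have hd0 : 0 < d := by rw [hd]; linarith
      have h2 : ∀ᶠ z in 𝓝[<] y, Function.leftLim Φ y - d < Φ z :=
        (Φ.mono.tendsto_leftLim y).eventually_const_lt (by linarith)
      obtain ⟨w, hw, hwy⟩ := (h2.and self_mem_nhdsWithin).exists
      filter_upwards [Ioi_mem_nhds (mem_Iio.1 hwy),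
        (hs.continuous.tendsto y).eventually_lt_const
        (show f.statCDF y < f.statCDF y + d by linarith)] with z a b
      have := Φ.mono.le_leftLim (mem_Ioi.1 a)
      linarith
    · have : Tendsto (Function.leftLim Φ) atBot (𝓝 0) :=
        tendsto_of_tendsto_of_tendsto_of_le_of_le
          (h0.comp (tendsto_atBot_add_const_right _ (-1) tendsto_id)) h0 hsand hl
      simpa using hs.tendsto_atBot.sub this
    · have : Tendsto (Function.leftLim Φ) atTop (𝓝 1) :=
        tendsto_of_tendsto_of_tendsto_of_le_of_le
          (h1.comp (tendsto_atTop_add_const_right _ (-1) tendsto_id)) h1 hsand hl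
      simpa using hs.tendsto_atTop.sub this
    · intro z
      rw [transfer_sub, hs.transfer_eq]
      refine (congrArg _ ?_).le
      have left : ∀ e : ℝ ≃o ℝ, Tendsto (fun w => Φ (e w)) (𝓝[<] z)
          (𝓝 (Function.leftLim Φ (e z))) := fun e => by
        refine (Φ.mono.tendsto_leftLim (e z)).comp (tendsto_nhdsWithin_iff.2
          ⟨(e.continuous.tendsto z).mono_left nhdsWithin_le_nhds, ?_⟩)
        filter_upwards [self_mem_nhdsWithin] with w hw
        exact e.strictMono hw
      refine tendsto_nhds_unique (Φ.mono.tendsto_leftLim z) ?_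
      refine (((left f.inv₀).const_mul (f.p : ℝ)).add ((left f.inv₁).const_mul (1 - (f.p : ℝ)))).congr
        fun w => hΦ w
  exact funext fun y => le_antisymm (le1 y) ((le2 y).trans (hl y))

variable {f} in
lemma IsStationary.cdf_eq {μ : Measure OpenI} [IsProbabilityMeasure μ] (h : f.IsStationary μ) :
    (cdf (μ.map H) : ℝ → ℝ) = f.statCDF :=
  StieltjesFunction.eq_statCDF f (tendsto_cdf_atBot _) (tendsto_cdf_atTop _)
    ((f.isStationary_iff μ).1 h)

/-- The stationary distribution function as a Stieltjes function. -/
noncomputable def statStieltjes : StieltjesFunction ℝ where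
  toFun := f.statCDF
  mono' := f.isStationaryCDF_statCDF.monotone
  right_continuous' _ := f.isStationaryCDF_statCDF.continuous.continuousWithinAt

/-- The stationary measure in the coordinate `h`. -/
noncomputable def lineMeasure : Measure ℝ := f.statStieltjes.measure

instance : IsProbabilityMeasure f.lineMeasure :=
  f.statStieltjes.isProbabilityMeasure f.isStationaryCDF_statCDF.tendsto_atBot
    f.isStationaryCDF_statCDF.tendsto_atTop

lemma cdf_lineMeasure : (cdf f.lineMeasure : ℝ → ℝ) = f.statCDF := by
  rw [lineMeasure, cdf_measure_stieltjesFunction _ f.isStationaryCDF_statCDF.tendsto_atBot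
    f.isStationaryCDF_statCDF.tendsto_atTop]
  rfl

lemma lineMeasure_Ioc (a b : ℝ) :
    f.lineMeasure (Ioc a b) = ENNReal.ofReal (f.statCDF b - f.statCDF a) :=
  f.statStieltjes.measure_Ioc a b

instance : NullSingletonClass f.lineMeasure where
  measure_singleton y := by
    have h1 : ContinuousAt f.statStieltjes y := f.isStationaryCDF_statCDF.continuous.continuousAt
    rw [lineMeasure, StieltjesFunction.measure_singleton,
      h1.continuousWithinAt.leftLim_eq, sub_self, ENNReal.ofReal_zero]

/-- The stationary measure. -/
noncomputable def statMeasure : ProbabilityMeasure OpenI :=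
  ⟨f.lineMeasure.map HMeas.symm, Measure.isProbabilityMeasure_map HMeas.symm.measurable.aemeasurable⟩

lemma map_H_statMeasure : (f.statMeasure : Measure OpenI).map H = f.lineMeasure := by
  change (f.lineMeasure.map HMeas.symm).map HMeas = _
  rw [Measure.map_map HMeas.measurable HMeas.symm.measurable, MeasurableEquiv.self_comp_symm,
    Measure.map_id]

lemma statMeasure_apply (s : Set OpenI) :
    (f.statMeasure : Measure OpenI) s = f.lineMeasure (H.symm ⁻¹' s) :=
  HMeas.symm.map_apply s

lemma isStationary_statMeasure : f.IsStationary f.statMeasure := by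
  rw [isStationary_iff, map_H_statMeasure, cdf_lineMeasure]
  exact f.isStationaryCDF_statCDF.transfer_eq

variable {f} in
lemma IsStationary.eq_statMeasure {μ : ProbabilityMeasure OpenI} (h : f.IsStationary μ) :
    μ = f.statMeasure := by
  refine Subtype.ext ?_
  change (μ : Measure OpenI) = f.statMeasure
  refine map_H_injective (Measure.eq_of_cdf _ _ (StieltjesFunction.ext fun y => ?_))
  exact (congrFun h.cdf_eq y).trans (congrFun f.isStationary_statMeasure.cdf_eq y).symm

lemma statMeasure_singleton (x : OpenI) : (f.statMeasure : Measure OpenI) {x} = 0 := by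
  rw [statMeasure_apply]
  have : (H.symm ⁻¹' {x} : Set ℝ) = {H x} := by
    ext y
    simp only [mem_preimage, mem_singleton_iff]
    exact H.symm_apply_eq
  rw [this, measure_singleton]

end RDS

/-! ### Lebesgue measure in the coordinate -/

/-- Lebesgue measure on `(0, 1)` in the coordinate `h`. -/
noncomputable def lebLine : Measure ℝ := lebesgue.map HMeas

instance : IsFiniteMeasure lebesgue where
  measure_univ_lt_top := by
    rw [lebesgue, (MeasurableEmbedding.subtype_coe measurableSet_Ioo).comap_apply]
    exact (measure_mono (show Subtype.val '' (univ : Set OpenI) ⊆ Icc (0 : ℝ) 1 by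
      rintro _ ⟨x, -, rfl⟩; exact ⟨x.2.1.le, x.2.2.le⟩)).trans_lt measure_Icc_lt_top

instance : IsFiniteMeasure lebLine := Measure.isFiniteMeasure_map _ _

instance : NullSingletonClass lebesgue where
  measure_singleton x := by
    rw [lebesgue, (MeasurableEmbedding.subtype_coe measurableSet_Ioo).comap_apply,
      image_singleton, measure_singleton]

lemma lebLine_apply (s : Set ℝ) : lebLine s = lebesgue (H ⁻¹' s) := HMeas.map_apply s

instance : NullSingletonClass lebLine where
  measure_singleton y := by
    have : (H ⁻¹' {y} : Set OpenI) = {H.symm y} := by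
      ext x
      simp only [mem_preimage, mem_singleton_iff]
      exact (H.eq_symm_apply).symm
    rw [lebLine_apply, this, measure_singleton]

/-! ### Typicality in terms of the distribution function -/

namespace RDS

variable (f : RDS)

lemma mutuallySingular_statMeasure_iff :
    (f.statMeasure : Measure OpenI).MutuallySingular lebesgue ↔
      f.lineMeasure.MutuallySingular lebLine := by
  constructor
  · rintro ⟨s, hs, h1, h2⟩
    refine ⟨H.symm ⁻¹' s, HMeas.symm.measurable hs, by rw [← statMeasure_apply, h1], ?_⟩
    rw [lebLine_apply, ← preimage_compl, ← preimage_comp, H_symm_comp, preimage_id, h2]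
  · rintro ⟨s, hs, h1, h2⟩
    refine ⟨H ⁻¹' s, measurable_H hs, ?_, ?_⟩
    · rw [statMeasure_apply, ← preimage_comp, H_comp_symm, preimage_id, h1]
    · rw [← preimage_compl, ← lebLine_apply, h2]

lemma fullSupport_statMeasure_iff :
    (∀ U : Set OpenI, IsOpen U → U.Nonempty → 0 < (f.statMeasure : Measure OpenI) U) ↔
      StrictMono f.statCDF := by
  constructor
  · intro hU x y hxy
    have h1 := hU (H ⁻¹' Ioo x y) (isOpen_Ioo.preimage continuous_H)
      ((nonempty_Ioo.2 hxy).preimage H.surjective)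
    rw [statMeasure_apply, ← preimage_comp, H_comp_symm, preimage_id] at h1
    have h2 := h1.trans_le (measure_mono Ioo_subset_Ioc_self)
    rw [lineMeasure_Ioc, ENNReal.ofReal_pos] at h2
    linarith
  · intro hm U hU hne
    rw [statMeasure_apply]
    obtain ⟨y, hy⟩ := hne.preimage H.symm.surjective
    obtain ⟨ε, hε, hball⟩ := Metric.isOpen_iff.1 (hU.preimage continuous_H_symm) y hy
    have h1 : Ioc y (y + ε / 2) ⊆ H.symm ⁻¹' U := fun z hz => hball (by
      rw [Metric.mem_ball, Real.dist_eq, abs_lt]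
      constructor <;> linarith [hz.1, hz.2])
    refine lt_of_lt_of_le ?_ (measure_mono h1)
    rw [lineMeasure_Ioc, ENNReal.ofReal_pos]
    exact sub_pos.2 (hm (by linarith))

lemma isTypical_iff :
    f.IsTypical ↔ f.lineMeasure.MutuallySingular lebLine ∧ StrictMono f.statCDF := by
  rw [← mutuallySingular_statMeasure_iff, ← fullSupport_statMeasure_iff]
  constructor
  · rintro ⟨μ, h1, -, h2, h3, -⟩
    obtain rfl := h1.eq_statMeasure
    exact ⟨h2, h3⟩
  · rintro ⟨h2, h3⟩
    exact ⟨f.statMeasure, f.isStationary_statMeasure, fun ν hν => hν.eq_statMeasure, h2, h3,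
      f.statMeasure_singleton⟩

/-! ### The `G_δ` property -/

/-- The half-open cells of length `1 / (N + 1)` with indices in `s`. -/
def cells (N : ℕ) (s : Finset ℤ) : Set ℝ := {y | ⌈((N : ℝ) + 1) * y⌉ ∈ s}

/-- The mass that the stationary measure gives to `cells N s`. -/
noncomputable def cellMass (N : ℕ) (s : Finset ℤ) : ℝ :=
  ∑ k ∈ s, (f.statCDF (k / ((N : ℝ) + 1)) - f.statCDF (((k : ℝ) - 1) / ((N : ℝ) + 1)))

lemma lineMeasure_cells (N : ℕ) (s : Finset ℤ) :
    f.lineMeasure (cells N s) = ENNReal.ofReal (f.cellMass N s) := by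
  have hN : (0 : ℝ) < (N : ℝ) + 1 := by positivity
  have h1 : cells N s = ⋃ k ∈ s, Ioc (((k : ℝ) - 1) / ((N : ℝ) + 1)) (k / ((N : ℝ) + 1)) := by
    ext y
    simp only [cells, mem_iUnion, mem_Ioc, mem_ofPred_eq, div_lt_iff₀ hN, le_div_iff₀ hN,
      exists_prop]
    refine ⟨fun h => ⟨_, h, ?_⟩, ?_⟩
    · have h2 := (Int.ceil_eq_iff (a := ((N : ℝ) + 1) * y)).1 rfl
      rwa [mul_comm y]
    · rintro ⟨k, hk, h2⟩
      rw [mul_comm y] at h2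
      rwa [Int.ceil_eq_iff.2 h2]
  rw [h1, measure_biUnion_finset _ fun k _ => measurableSet_Ioc, cellMass,
    ENNReal.ofReal_sum_of_nonneg]
  · exact Finset.sum_congr rfl fun k _ => f.lineMeasure_Ioc _ _
  · exact fun k _ => sub_nonneg.2 (f.isStationaryCDF_statCDF.monotone
      (div_le_div_of_nonneg_right (by linarith) hN.le))
  · intro k _ l _ hkl
    refine Set.disjoint_left.2 fun y hk hl => hkl ?_
    simp only [mem_Ioc, div_lt_iff₀ hN, le_div_iff₀ hN] at hk hl
    rw [← Int.ceil_eq_iff.2 hk, Int.ceil_eq_iff.2 hl]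

lemma measurableSet_cells (N : ℕ) (s : Finset ℤ) : MeasurableSet (cells N s) :=
  (Int.measurable_ceil.comp (measurable_const_mul _)) s.measurableSet

/-- The systems whose stationary measure is concentrated, up to `ε`, on finitely many cells of
small Lebesgue measure. -/
def nearlySingular (ε : ℝ) : Set RDS :=
  ⋃ (N : ℕ) (s : Finset ℤ) (_ : lebLine (cells N s) < ENNReal.ofReal ε),
    {f | 1 - ε < f.cellMass N s}

/-- The mass of finitely many cells is a finite sum of values of `statCDF`, each continuous in the
system, while the Lebesgue condition does not involve the system. -/
lemma isOpen_nearlySingular (ε : ℝ) : IsOpen (nearlySingular ε) := by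
  refine isOpen_iUnion fun N => isOpen_iUnion fun s => isOpen_iUnion fun _ =>
    isOpen_lt continuous_const ?_
  exact continuous_finsetSum _ fun k _ => (continuous_statCDF _).sub (continuous_statCDF _)

variable {f} in
-- Inner regularity gives a compact `K ⊆ U` of almost the same mass. On a grid finer than a
-- thickening radius of `K` inside `U`, the finitely many cells meeting `K` cover it and stay in
-- `U`.
lemma mem_nearlySingular_of_isOpen {ε : ℝ} (hε : ε ≤ 1) {U : Set ℝ} (hU : IsOpen U)
    (h1 : lebLine U < ENNReal.ofReal ε) (h2 : ENNReal.ofReal (1 - ε) < f.lineMeasure U) :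
    f ∈ nearlySingular ε := by
  obtain ⟨K, hKU, hK, hK2⟩ := hU.exists_lt_isCompact h2
  obtain ⟨δ, hδ, hδU⟩ := hK.exists_thickening_subset_open hU hKU
  obtain ⟨N, hN⟩ := exists_nat_one_div_lt hδ
  have hNp : (0 : ℝ) < (N : ℝ) + 1 := by positivity
  have hfin : ((fun y : ℝ => ⌈((N : ℝ) + 1) * y⌉) '' K).Finite := by
    obtain ⟨a, ha⟩ := hK.bddBelow
    obtain ⟨b, hb⟩ := hK.bddAbove
    refine (finite_Icc ⌈((N : ℝ) + 1) * a⌉ ⌈((N : ℝ) + 1) * b⌉).subset ?_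
    rintro _ ⟨y, hy, rfl⟩
    exact ⟨Int.ceil_mono (mul_le_mul_of_nonneg_left (ha hy) hNp.le),
      Int.ceil_mono (mul_le_mul_of_nonneg_left (hb hy) hNp.le)⟩
  have hKc : K ⊆ cells N hfin.toFinset := fun y hy => by
    simp only [cells, mem_ofPred_eq, Finite.mem_toFinset]
    exact ⟨y, hy, rfl⟩
  have hcU : cells N hfin.toFinset ⊆ U := by
    intro y hy
    simp only [cells, mem_ofPred_eq, Finite.mem_toFinset] at hy
    obtain ⟨z, hz, hyz⟩ := hy
    refine hδU (Metric.mem_thickening_iff.2 ⟨z, hz, lt_of_lt_of_le ?_ hN.le⟩)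
    rw [lt_div_iff₀ hNp, Real.dist_eq, ← abs_of_pos hNp, ← abs_mul, abs_lt]
    have a1 := (Int.ceil_eq_iff (a := ((N : ℝ) + 1) * y)).1 rfl
    have a2 := (Int.ceil_eq_iff (a := ((N : ℝ) + 1) * z)).1 rfl
    simp only at hyz
    rw [hyz] at a2
    constructor <;> nlinarith [a1.1, a1.2, a2.1, a2.2]
  simp only [nearlySingular, mem_iUnion]
  refine ⟨N, hfin.toFinset, (measure_mono hcU).trans_lt h1, ?_⟩
  have h3 := hK2.trans_le (measure_mono hKc)
  rw [lineMeasure_cells, ENNReal.ofReal_lt_ofReal_iff_of_nonneg (sub_nonneg.2 hε)] at h3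
  exact h3

/-- One direction is outer regularity of Lebesgue measure around a null set of full stationary mass.
The other is Borel–Cantelli: with errors summable in `n`, the limsup of the concentrating sets is
Lebesgue null and its complement, a liminf of complements, is null for the stationary measure. -/
lemma mutuallySingular_iff_forall_mem_nearlySingular :
    f.lineMeasure.MutuallySingular lebLine ↔ ∀ n : ℕ, f ∈ nearlySingular ((1 / 2) ^ n) := by
  constructor
  · rintro ⟨s, hs, h1, h2⟩ n
    have hε : (0 : ℝ) < (1 / 2) ^ n := by positivity
    obtain ⟨U, hsU, hU, hUl⟩ := sᶜ.exists_isOpen_lt_of_lt (μ := lebLine)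
      (ENNReal.ofReal ((1 / 2) ^ n)) (by rw [h2]; exact ENNReal.ofReal_pos.2 hε)
    refine mem_nearlySingular_of_isOpen (pow_le_one₀ (by norm_num) (by norm_num)) hU hUl ?_
    have h3 : f.lineMeasure U = 1 := by
      refine le_antisymm prob_le_one ?_
      rw [← prob_compl_eq_one_iff hs] at h1
      exact h1.ge.trans (measure_mono hsU)
    rw [h3, ENNReal.ofReal_lt_one]
    linarith
  · intro hf
    have hf' : ∀ n : ℕ, ∃ A : Set ℝ, MeasurableSet A ∧ lebLine A < ENNReal.ofReal ((1 / 2) ^ n) ∧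
        f.lineMeasure Aᶜ ≤ ENNReal.ofReal ((1 / 2) ^ n) := by
      intro n
      have := hf n
      simp only [nearlySingular, mem_iUnion] at this
      obtain ⟨N, s, h1, h2⟩ := this
      refine ⟨cells N s, measurableSet_cells N s, h1, ?_⟩
      rw [prob_compl_eq_one_sub (measurableSet_cells N s), lineMeasure_cells,
        ← ENNReal.ofReal_one, ← ENNReal.ofReal_sub _ ?_]
      · exact ENNReal.ofReal_le_ofReal (by linarith [mem_ofPred_eq ▸ h2])
      · have hp : ((1 : ℝ) / 2) ^ n ≤ 1 := pow_le_one₀ (by norm_num) (by norm_num)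
        have h3 : 1 - (1 / 2) ^ n < f.cellMass N s := h2
        linarith
    choose A hA hA1 hA2 using hf'
    have hsum : Summable fun n : ℕ => ((1 : ℝ) / 2) ^ n := summable_geometric_two
    refine Measure.MutuallySingular.symm ⟨limsup A atTop, .measurableSet_limsup hA, ?_, ?_⟩
    · refine measure_limsup_atTop_eq_zero (ne_top_of_le_ne_top ?_
        (ENNReal.tsum_le_tsum fun n => (hA1 n).le))
      rw [← ENNReal.ofReal_tsum_of_nonneg (fun n => by positivity) hsum]
      exact ENNReal.ofReal_ne_top
    · have : (limsup A atTop)ᶜ = liminf (fun n => (A n)ᶜ) atTop := by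
        rw [limsup_compl]; rfl
      rw [this]
      refine measure_liminf_atTop_eq_zero (ne_top_of_le_ne_top ?_
        (ENNReal.tsum_le_tsum fun n => hA2 n))
      rw [← ENNReal.ofReal_tsum_of_nonneg (fun n => by positivity) hsum]
      exact ENNReal.ofReal_ne_top

lemma strictMono_statCDF_iff :
    StrictMono f.statCDF ↔ ∀ q r : ℚ, q < r → f.statCDF q < f.statCDF r := by
  refine ⟨fun h q r hqr => h (by exact_mod_cast hqr), fun hq x y hxy => ?_⟩
  have hm := f.isStationaryCDF_statCDF.monotone
  obtain ⟨q, hxq, hqy⟩ := exists_rat_btwn hxy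
  obtain ⟨r, hqr, hry⟩ := exists_rat_btwn hqy
  calc f.statCDF x ≤ f.statCDF q := hm hxq.le
    _ < f.statCDF r := hq q r (by exact_mod_cast hqr)
    _ ≤ f.statCDF y := hm hry.le

lemma isGδ_strictMono_statCDF : IsGδ {f : RDS | StrictMono f.statCDF} := by
  have : {f : RDS | StrictMono f.statCDF} =
      ⋂ q : ℚ, ⋂ r : ℚ, {f | q < r → f.statCDF q < f.statCDF r} := by
    ext f
    simp only [mem_ofPred_eq, strictMono_statCDF_iff, mem_iInter]
  rw [this]
  refine .iInter fun q => .iInter fun r => IsOpen.isGδ ?_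
  by_cases hqr : q < r
  · simpa [hqr] using isOpen_lt (continuous_statCDF q) (continuous_statCDF r)
  · simp [hqr]

lemma setOf_isTypical_eq : {f : RDS | f.IsTypical} =
    (⋂ n : ℕ, nearlySingular ((1 / 2) ^ n)) ∩ {f : RDS | StrictMono f.statCDF} := by
  ext f
  simp only [mem_ofPred_eq, isTypical_iff, mutuallySingular_iff_forall_mem_nearlySingular,
    mem_inter_iff, mem_iInter]

lemma isGδ_isTypical : IsGδ {f : RDS | f.IsTypical} := by
  rw [setOf_isTypical_eq]
  exact (IsGδ.iInter fun n => (isOpen_nearlySingular _).isGδ).inter isGδ_strictMono_statCDF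

end RDS

/-! ### Systems with prescribed coordinate expressions -/

namespace RDS

/-- The displacement tends to minus the logarithm of the derivative at `1`, hence the reversed sign
in the condition on `b₀` and `b₁`. -/
lemma exists_of_coord {F₀ F₁ : ℝ → ℝ} {a₀ a₁ b₀ b₁ : ℝ} {p : unitInterval}
    (hc₀ : Continuous F₀) (hc₁ : Continuous F₁) (hm₀ : StrictMono F₀) (hm₁ : StrictMono F₁)
    (hlt₀ : ∀ y, F₀ y < y) (hlt₁ : ∀ y, y < F₁ y)
    (ha₀ : Tendsto (fun y => F₀ y - y) atBot (𝓝 a₀))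
    (ha₁ : Tendsto (fun y => F₁ y - y) atBot (𝓝 a₁))
    (hb₀ : Tendsto (fun y => F₀ y - y) atTop (𝓝 b₀))
    (hb₁ : Tendsto (fun y => F₁ y - y) atTop (𝓝 b₁)) (hp : p ∈ Ioo (0 : unitInterval) 1)
    (ha : 0 < (p : ℝ) * a₀ + (1 - p) * a₁) (hb : (p : ℝ) * b₀ + (1 - p) * b₁ < 0) :
    ∃ g : RDS, g.f₀.coord = F₀ ∧ g.f₁.coord = F₁ ∧ g.p = p := by
  obtain ⟨g₀, rfl⟩ := CI.exists_coord_eq hc₀ ha₀ hb₀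
  obtain ⟨g₁, rfl⟩ := CI.exists_coord_eq hc₁ ha₁ hb₁
  refine ⟨⟨(g₀, g₁, p), (CI.isHomeomorph_iff _).2 hm₀, (CI.isHomeomorph_iff _).2 hm₁,
    (CI.below_iff _).2 hlt₀, (CI.above_iff _).2 hlt₁, hp, ?_, ?_⟩, rfl, rfl, rfl⟩
  · unfold lyapunov
    rwa [tendsto_nhds_unique g₀.tendsto_disp_atBot ha₀,
      tendsto_nhds_unique g₁.tendsto_disp_atBot ha₁]
  · have h₀ := tendsto_nhds_unique g₀.tendsto_disp_atTop hb₀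
    have h₁ := tendsto_nhds_unique g₁.tendsto_disp_atTop hb₁
    unfold lyapunov
    dsimp only
    rw [← h₀, ← h₁] at hb
    linarith

lemma dist_le_of_coord {f g : RDS} {r : ℝ} (h₀ : ∀ y, |f.f₀.coord y - g.f₀.coord y| ≤ r)
    (h₁ : ∀ y, |f.f₁.coord y - g.f₁.coord y| ≤ r) (hp : f.p = g.p) : dist f g ≤ r := by
  rw [dist_eq_max, hp, sub_self, abs_zero]
  exact max_le (CI.dist_le_of_coord h₀)
    (max_le (CI.dist_le_of_coord h₁) ((abs_nonneg _).trans (h₀ 0)))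

variable (f : RDS)

lemma statCDF_nonneg (y : ℝ) : 0 ≤ f.statCDF y :=
  f.isStationaryCDF_statCDF.monotone.le_of_tendsto f.isStationaryCDF_statCDF.tendsto_atBot y

lemma statCDF_eq (y : ℝ) :
    f.p * f.statCDF (f.inv₀ y) + (1 - f.p) * f.statCDF (f.inv₁ y) = f.statCDF y :=
  f.isStationaryCDF_statCDF.transfer_eq y

/-- The stationary distribution function is positive. -/
lemma statCDF_pos (y : ℝ) : 0 < f.statCDF y := by
  have hs := f.isStationaryCDF_statCDF
  refine lt_of_not_ge fun hy => ?_
  -- At the supremum of the zero set, the fixed-point equation forces a zero at its image under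
  -- `f.inv₀`, which lies further right.
  set A : Set ℝ := {z | f.statCDF z ≤ 0} with hA
  have hcl : IsClosed A := isClosed_le hs.continuous continuous_const
  obtain ⟨b, hb⟩ := eventually_atTop.1 (hs.tendsto_atTop.eventually_const_lt one_pos)
  have hbdd : BddAbove A := ⟨b, fun z hz => not_lt.1 fun h => (hb z h.le).not_ge hz⟩
  have hsup : f.statCDF (sSup A) ≤ 0 := hcl.csSup_mem ⟨y, hy⟩ hbdd
  have h1 := f.statCDF_eq (sSup A)
  have h2 := mul_nonneg f.one_sub_p_pos.le (f.statCDF_nonneg (f.inv₁ (sSup A)))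
  have h3 : f.statCDF (f.inv₀ (sSup A)) ≤ 0 := by
    by_contra! h
    have := mul_pos f.p_pos h
    linarith
  exact (le_csSup hbdd h3).not_gt (f.lt_inv₀ _)

variable {f}

/-- Both terms of the fixed-point equation are nondecreasing with positive weights, so if their sum
does not grow, neither term does. Flat intervals are thus carried to flat intervals by both inverse
maps. -/
lemma statCDF_inv_eq_of_eq {x y : ℝ} (hxy : x ≤ y) (h : f.statCDF x = f.statCDF y) :
    f.statCDF (f.inv₀ x) = f.statCDF (f.inv₀ y) ∧
      f.statCDF (f.inv₁ x) = f.statCDF (f.inv₁ y) := by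
  have hm := f.isStationaryCDF_statCDF.monotone
  have h0 := hm (f.inv₀.monotone hxy)
  have h1 := hm (f.inv₁.monotone hxy)
  have e1 := f.statCDF_eq x
  have e2 := f.statCDF_eq y
  constructor
  · by_contra hne
    have := mul_lt_mul_of_pos_left (lt_of_le_of_ne h0 hne) f.p_pos
    have := mul_le_mul_of_nonneg_left h1 f.one_sub_p_pos.le
    linarith
  · by_contra hne
    have := mul_lt_mul_of_pos_left (lt_of_le_of_ne h1 hne) f.one_sub_p_pos
    have := mul_le_mul_of_nonneg_left h0 f.p_pos.le
    linarith

/-- Otherwise the decreasing orbit would converge to a fixed point of `f.inv₁`, and there is none.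
-/
lemma exists_iterate_inv₁_le (y Z : ℝ) : ∃ n : ℕ, f.inv₁^[n] y ≤ Z := by
  by_contra! h
  have hanti : Antitone fun n => f.inv₁^[n] y := antitone_nat_of_succ_le fun n => by
    rw [Function.iterate_succ_apply']; exact (f.inv₁_lt _).le
  have hlim := tendsto_atTop_ciInf hanti ⟨Z, by rintro _ ⟨n, rfl⟩; exact (h n).le⟩
  have := isFixedPt_of_tendsto_iterate hlim f.inv₁.continuous.continuousAt
  exact (f.inv₁_lt _).ne this

end RDS

/-! ### Full support is dense -/

lemma exists_nat_mul_sub_nat_mul_mem_Ioo {α β l : ℝ} (hα : 0 < α) (hβ : 0 < β)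
    (hirr : Irrational (β / α)) (hl : 0 < l) :
    ∃ k m : ℕ, (k : ℝ) * β - m * α ∈ Ioo (-l) 0 := by
  have hne : ∀ k m : ℕ, 0 < k → (k : ℝ) * β ≠ m * α := by
    intro k m hk h
    refine hirr ⟨(m : ℚ) / k, ?_⟩
    have : (k : ℝ) ≠ 0 := by exact_mod_cast hk.ne'
    push_cast
    rw [div_eq_div_iff this hα.ne', ← h, mul_comm]
  obtain ⟨n, hn⟩ := exists_nat_one_div_lt (div_pos hl hα)
  -- Dirichlet approximation makes `k * β - m * α` small; irrationality makes it nonzero.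
  obtain ⟨k, hk, -, hkr⟩ := Real.exists_nat_abs_mul_sub_round_le (β / α) (Nat.succ_pos n)
  obtain ⟨m, hm⟩ : ∃ m : ℕ, round ((k : ℝ) * (β / α)) = m := by
    refine Int.eq_ofNat_of_zero_le ?_
    rw [round_eq]
    exact Int.floor_nonneg.2 (by positivity)
  rw [hm, Int.cast_natCast] at hkr
  have h1 : |(k : ℝ) * β - m * α| < l := by
    have e : (k : ℝ) * β - m * α = ((k : ℝ) * (β / α) - m) * α := by field_simp
    rw [e, abs_mul, abs_of_pos hα, ← lt_div_iff₀ hα]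
    refine lt_of_le_of_lt (hkr.trans ?_) hn
    push_cast
    exact one_div_le_one_div_of_le (by positivity) (by linarith)
  rw [abs_lt] at h1
  rcases lt_or_gt_of_ne (sub_ne_zero.2 (hne k m hk)) with hd | hd
  · exact ⟨k, m, h1.1, hd⟩
  -- If the small difference `d` is positive, the largest multiple of `d` not exceeding `α`, minus
  -- `α`, lies in `(-d, 0]`, and irrationality excludes `0`.
  · set d := (k : ℝ) * β - m * α with hd'
    have j1 := Nat.floor_le (div_pos hα hd).le
    have j2 := Nat.lt_floor_add_one (α / d)
    rw [le_div_iff₀ hd] at j1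
    rw [div_lt_iff₀ hd] at j2
    set j := ⌊α / d⌋₊
    have e : ((j * k : ℕ) : ℝ) * β - ((j * m + 1 : ℕ) : ℝ) * α = j * d - α := by
      rw [hd']; push_cast; ring
    refine ⟨j * k, j * m + 1, ?_⟩
    rw [e]
    refine ⟨by linarith [h1.2], lt_of_le_of_ne (by linarith) ?_⟩
    rcases Nat.eq_zero_or_pos j with h0 | h0
    · rw [h0, Nat.cast_zero, zero_mul, zero_sub]
      exact (neg_neg_of_pos hα).ne
    · rw [← e]
      exact sub_ne_zero.2 (hne _ _ (Nat.mul_pos h0 hk))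

namespace RDS

/-- If near `-∞` both maps are translations, by amounts of irrational ratio, then the stationary
measure has full support. -/
lemma strictMono_statCDF_of_translations {f : RDS} {Z α β : ℝ} (hα : 0 < α) (hβ : 0 < β)
    (hirr : Irrational (β / α)) (h₀ : ∀ y ≤ Z, f.f₀.coord y = y - β)
    (h₁ : ∀ y ≤ Z, f.f₁.coord y = y + α) : StrictMono f.statCDF := by
  have hs := f.isStationaryCDF_statCDF
  have inv0 : ∀ y, y + β ≤ Z → f.inv₀ y = y + β := fun y hy => by
    rw [← f.inv₀_coord₀ (y + β), h₀ _ hy, add_sub_cancel_right]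
  have inv1 : ∀ y, y ≤ Z → f.inv₁ y = y - α := fun y hy => by
    rw [← f.inv₁_coord₁ (y - α), h₁ _ (by linarith), sub_add_cancel]
  refine hs.monotone.strictMono_of_injective ?_
  by_contra hinj
  obtain ⟨x, y, hxy, hflat⟩ : ∃ x y, x < y ∧ f.statCDF x = f.statCDF y := by
    simp only [Function.Injective, not_forall] at hinj
    obtain ⟨x, y, h, hne⟩ := hinj
    rcases lt_or_gt_of_ne hne with h' | h'
    · exact ⟨x, y, h', h⟩
    · exact ⟨y, x, h', h.symm⟩
  -- Iterating `f.inv₁` moves the flat interval into the region where both maps are translations.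
  obtain ⟨x, y, hxy, hflat, hyZ⟩ :
      ∃ x y, x < y ∧ f.statCDF x = f.statCDF y ∧ y ≤ Z := by
    obtain ⟨n, hn⟩ := exists_iterate_inv₁_le (f := f) y Z
    have key : ∀ n : ℕ, f.inv₁^[n] x < f.inv₁^[n] y ∧
        f.statCDF (f.inv₁^[n] x) = f.statCDF (f.inv₁^[n] y) := by
      intro n
      induction n with
      | zero => exact ⟨hxy, hflat⟩
      | succ n ih =>
        rw [Function.iterate_succ_apply', Function.iterate_succ_apply']
        exact ⟨f.inv₁.strictMono ih.1, (statCDF_inv_eq_of_eq ih.1.le ih.2).2⟩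
    exact ⟨_, _, (key n).1, (key n).2, hn⟩
  obtain ⟨k, m, hd1, hd2⟩ := exists_nat_mul_sub_nat_mul_mem_Ioo hα hβ hirr (sub_pos.2 hxy)
  set d := (k : ℝ) * β - m * α with hd
  have down : ∀ (n : ℕ) (u v : ℝ), u ≤ v → v ≤ Z → f.statCDF u = f.statCDF v →
      f.statCDF (u - n * α) = f.statCDF (v - n * α) := by
    intro n
    induction n with
    | zero => intro u v _ _ h; simpa using h
    | succ n ih =>
      intro u v huv hv h
      have h2 := (statCDF_inv_eq_of_eq huv h).2
      rw [inv1 u (huv.trans hv), inv1 v hv] at h2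
      have := ih (u - α) (v - α) (by linarith) (by linarith) h2
      push_cast
      convert this using 2 <;> ring
  have up : ∀ (n : ℕ) (u v : ℝ), u ≤ v → v + n * β ≤ Z → f.statCDF u = f.statCDF v →
      f.statCDF (u + n * β) = f.statCDF (v + n * β) := by
    intro n
    induction n with
    | zero => intro u v _ _ h; simpa using h
    | succ n ih =>
      intro u v huv hv h
      push_cast at hv
      have hn : 0 ≤ (n : ℝ) * β := by positivity
      have h2 := (statCDF_inv_eq_of_eq huv h).1
      rw [inv0 u (by linarith), inv0 v (by linarith)] at h2
      have := ih (u + β) (v + β) (by linarith) (by linarith) h2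
      push_cast
      convert this using 2 <;> ring
  -- All steps down are made before the steps up, so that the points never leave the half-line below
  -- `Z`.
  have shift : ∀ u v : ℝ, u ≤ v → v ≤ Z → f.statCDF u = f.statCDF v →
      f.statCDF (u + d) = f.statCDF (v + d) := by
    intro u v huv hv h
    have := up k (u - m * α) (v - m * α) (by linarith) (by rw [hd] at hd2; linarith)
      (down m u v huv hv h)
    convert this using 2 <;> rw [hd] <;> ring
  -- As `-(y - x) < d < 0`, consecutive shifts of the flat interval overlap, so the distribution
  -- function is constant from `y` down to $-\infty$ and hence `0`.
  have chain : ∀ j : ℕ, f.statCDF (x + j * d) = f.statCDF (y + j * d) ∧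
      f.statCDF (y + j * d) = f.statCDF y := by
    intro j
    induction j with
    | zero => simpa using hflat
    | succ j ih =>
      have hj : (j : ℝ) * d ≤ 0 := mul_nonpos_of_nonneg_of_nonpos (by positivity) hd2.le
      have h1 := shift _ _ (by linarith) (by linarith) ih.1
      have e : ∀ w : ℝ, w + ((j + 1 : ℕ) : ℝ) * d = w + j * d + d := fun w => by push_cast; ring
      rw [e, e]
      refine ⟨h1, le_antisymm ?_ ?_⟩
      · exact hs.monotone (by linarith)
      · rw [← ih.2, ← ih.1]
        exact hs.monotone (by linarith)
  have hlim : Tendsto (fun j : ℕ => f.statCDF (y + j * d)) atTop (𝓝 0) :=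
    hs.tendsto_atBot.comp (tendsto_atBot_add_const_left _ _
      (tendsto_natCast_atTop_atTop.atTop_mul_const_of_neg hd2))
  have h2 : f.statCDF y = 0 :=
    tendsto_nhds_unique (tendsto_const_nhds.congr fun j => (chain j).2.symm) hlim
  exact (f.statCDF_pos y).ne' h2

end RDS

/-- Below `Z` the function is a translation; above `Z` it is the convex combination of the identity
and `F` with weight `t` on `F`. -/
lemma strictMono_freeze {F : ℝ → ℝ} (hF : StrictMono F) {t : ℝ} (ht : 0 < t) (ht1 : t ≤ 1)
    (Z : ℝ) : StrictMono fun y => y + t * (F (max y Z) - max y Z) := by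
  intro y z hyz
  dsimp only
  rcases le_or_gt z Z with hz | hz
  · rw [max_eq_right hz, max_eq_right (hyz.le.trans hz)]
    linarith
  · rw [max_eq_left hz.le]
    have h1 : max y Z < z := max_lt hyz hz
    have h2 := mul_lt_mul_of_pos_left (hF h1) ht
    have h3 : t * (z - max y Z) ≤ 1 * (z - max y Z) :=
      mul_le_mul_of_nonneg_right ht1 (by linarith)
    have h4 := le_max_left y Z
    linarith

namespace RDS

/-- The systems whose stationary measure has full support are dense. -/
lemma dense_strictMono_statCDF : Dense {f : RDS | StrictMono f.statCDF} := by
  refine Metric.dense_iff.2 fun f ε hε => ?_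
  set a₀ := Real.log (derivI f.f₀.toMap 0)
  set a₁ := Real.log (derivI f.f₁.toMap 0)
  set b₀ := -Real.log (derivI f.f₀.toMap 1) with hb₀
  set b₁ := -Real.log (derivI f.f₁.toMap 1) with hb₁
  have ta₀ := f.f₀.tendsto_disp_atBot
  have ta₁ := f.f₁.tendsto_disp_atBot
  have tb₀ := f.f₀.tendsto_disp_atTop
  have tb₁ := f.f₁.tendsto_disp_atTop
  have hla : 0 < f.p * a₀ + (1 - f.p) * a₁ := f.2.lyapunov_zero
  have hlb : f.p * b₀ + (1 - f.p) * b₁ < 0 := by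
    have : 0 < f.p * (-b₀) + (1 - f.p) * (-b₁) := by
      rw [hb₀, hb₁, neg_neg, neg_neg]; exact f.2.lyapunov_one
    linarith
  obtain ⟨K, hK⟩ : ∃ K : ℝ, ∀ y, |f.f₀.coord y - y| ≤ K :=
    ⟨‖f.f₀.disp‖, fun y => f.f₀.disp.norm_coe_le_norm y⟩
  -- the point below which the displacements are frozen
  obtain ⟨Z, hZ⟩ := eventually_atBot.1
    (((Metric.tendsto_nhds.1 ta₀ (ε / 8) (by positivity)).and
      (Metric.tendsto_nhds.1 ta₁ (ε / 8) (by positivity))).and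
      (((ta₀.const_mul (f.p : ℝ)).add (ta₁.const_mul (1 - (f.p : ℝ)))).eventually_const_lt hla))
  set u := f.f₀.coord Z - Z with hu
  set v := f.f₁.coord Z - Z with hv
  have hu0 : u < 0 := sub_neg.2 (f.coord₀_lt Z)
  have hv0 : 0 < v := sub_pos.2 (f.lt_coord₁ Z)
  have hq : 0 < -u / v := div_pos (neg_pos.2 hu0) hv0
  have huv : 0 < f.p * u + (1 - f.p) * v := (hZ Z le_rfl).2
  -- the factor that makes the ratio irrational
  have hnear : ∀ᶠ t : ℝ in 𝓝 1, 0 < t ∧ (1 - t) * K < ε / 4 ∧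
      f.p * (t * b₀) + (1 - f.p) * b₁ < 0 := by
    refine (lt_mem_nhds one_pos).and (Eventually.and ?_ ?_)
    · have : Continuous fun t : ℝ => (1 - t) * K := by fun_prop
      exact (this.tendsto 1).eventually_lt_const (by simpa using hε)
    · have : Continuous fun t : ℝ => f.p * (t * b₀) + (1 - f.p) * b₁ := by fun_prop
      exact (this.tendsto 1).eventually_lt_const (by simpa using hlb)
  obtain ⟨l, hl, hlsub⟩ := exists_Ioc_subset_of_mem_nhds hnear ⟨0, one_pos⟩
  -- The translation lengths will be `t * (-u)` and `v`, so `t` is chosen to make their ratio an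
  -- irrational `r` just below `-u / v`. Taking `t < 1` helps the exponent at `0`, because `u < 0`,
  -- but weakens the one at `1`, hence the last clause of `hnear`.
  obtain ⟨r, hr, hlr, hr1⟩ := exists_irrational_btwn
    (show l * (-u / v) < 1 * (-u / v) from mul_lt_mul_of_pos_right hl hq)
  set t := r / (-u / v) with ht
  have htr : t * (-u / v) = r := div_mul_cancel₀ _ hq.ne'
  have hlt : l < t := (lt_div_iff₀ hq).2 hlr
  have ht1 : t < 1 := (div_lt_iff₀ hq).2 hr1
  obtain ⟨ht0, htK, htb⟩ := hlsub ⟨hlt, ht1.le⟩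
  have lim_bot : ∀ (s : ℝ) (F : ℝ → ℝ), Tendsto
      (fun y => y + s * (F (max y Z) - max y Z) - y) atBot (𝓝 (s * (F Z - Z))) := by
    intro s F
    refine tendsto_const_nhds.congr' ?_
    filter_upwards [eventually_le_atBot Z] with y hy
    rw [max_eq_right hy]; ring
  have lim_top : ∀ (s b : ℝ) (F : ℝ → ℝ), Tendsto (fun y => F y - y) atTop (𝓝 b) → Tendsto
      (fun y => y + s * (F (max y Z) - max y Z) - y) atTop (𝓝 (s * b)) := by
    intro s b F hF
    refine (hF.const_mul s).congr' ?_
    filter_upwards [eventually_ge_atTop Z] with y hy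
    rw [max_eq_left hy]; ring
  have c₀ := f.f₀.continuous_coord
  have c₁ := f.f₁.continuous_coord
  obtain ⟨g, hg₀, hg₁, hgp⟩ := exists_of_coord
    (F₀ := fun y => y + t * (f.f₀.coord (max y Z) - max y Z))
    (F₁ := fun y => y + 1 * (f.f₁.coord (max y Z) - max y Z)) (p := f.p)
    (by fun_prop) (by fun_prop)
    (strictMono_freeze f.strictMono_coord₀ ht0 ht1.le Z)
    (strictMono_freeze f.strictMono_coord₁ one_pos le_rfl Z)
    (fun y => by
      have := mul_pos ht0 (sub_pos.2 (f.coord₀_lt (max y Z)))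
      linarith)
    (fun y => by linarith [f.lt_coord₁ (max y Z)])
    (lim_bot _ _) (lim_bot _ _) (lim_top _ _ _ tb₀) (lim_top _ _ _ tb₁) f.2.prob
    (by
      rw [← hu, ← hv]
      have h1 : t * u ≥ 1 * u := mul_le_mul_of_nonpos_right ht1.le hu0.le
      have h2 := mul_le_mul_of_nonneg_left h1 f.p_pos.le
      linarith)
    (by rw [one_mul]; exact htb)
  refine ⟨g, ?_, ?_⟩
  · have freeze : ∀ {F : ℝ → ℝ} {a : ℝ}, (∀ y ≤ Z, dist (F y - y) a < ε / 8) → ∀ y,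
        |(F (max y Z) - max y Z) - (F y - y)| ≤ ε / 4 := by
      intro F a hF y
      rcases le_total y Z with hy | hy
      · rw [max_eq_right hy, ← Real.dist_eq]
        have := dist_triangle_right (F Z - Z) (F y - y) a
        linarith [hF Z le_rfl, hF y hy]
      · rw [max_eq_left hy, sub_self, abs_zero]; positivity
    refine (dist_le_of_coord (r := ε / 2) (fun y => ?_) (fun y => ?_) hgp).trans_lt (by linarith)
    · have h1 := freeze (fun y hy => (hZ y hy).1.1) y
      have h2 : |(1 - t) * (f.f₀.coord (max y Z) - max y Z)| ≤ ε / 4 := by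
        rw [abs_mul, abs_of_pos (sub_pos.2 ht1)]
        exact (mul_le_mul_of_nonneg_left (hK _) (sub_pos.2 ht1).le).trans htK.le
      rw [hg₀]
      dsimp only
      rw [abs_le] at h1 h2 ⊢
      constructor <;> linarith [h1.1, h1.2, h2.1, h2.2]
    · have h1 := freeze (fun y hy => (hZ y hy).1.2) y
      rw [hg₁]
      dsimp only
      rw [abs_le] at h1 ⊢
      constructor <;> linarith [h1.1, h1.2]
  · refine strictMono_statCDF_of_translations (Z := Z) (α := v) (β := t * (-u)) hv0
      (mul_pos ht0 (neg_pos.2 hu0)) ?_ ?_ ?_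
    · rw [mul_div_assoc, htr]; exact hr
    · intro y hy
      rw [hg₀]
      dsimp only
      rw [max_eq_right hy, ← hu]; ring
    · intro y hy
      rw [hg₁]
      dsimp only
      rw [max_eq_right hy, ← hv]; ring

end RDS

/-! ### Conjugation -/

/-- A continuous function with limits at both ends of the line is uniformly continuous. -/
lemma _root_.Continuous.uniformContinuous_of_tendsto_atBot_atTop {u : ℝ → ℝ} {a b : ℝ}
    (hu : Continuous u) (ha : Tendsto u atBot (𝓝 a)) (hb : Tendsto u atTop (𝓝 b)) :
    UniformContinuous u := by
  -- Subtracting a multiple of this ramp makes the two limits equal, as the criterion with a single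
  -- limit at infinity requires.
  have hcl : LipschitzWith 1 fun y : ℝ => max 0 (min 1 y) :=
    (LipschitzWith.id.const_min 1).const_max 0
  have hclu := hcl.uniformContinuous.const_mul' (b - a)
  have h1 : UniformContinuous fun y => u y - (b - a) * max 0 (min 1 y) := by
    refine Continuous.uniformContinuous_of_tendsto_cocompact (x := a) (by fun_prop) ?_
    rw [cocompact_eq_atBot_atTop]
    refine Tendsto.sup (ha.congr' ?_) ?_
    · filter_upwards [eventually_le_atBot 0] with y hy
      rw [min_eq_right (hy.trans zero_le_one), max_eq_left hy, mul_zero, sub_zero]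
    · have : Tendsto (fun y => u y - (b - a)) atTop (𝓝 a) := by
        simpa using hb.sub_const (b - a)
      refine this.congr' ?_
      filter_upwards [eventually_ge_atTop 1] with y hy
      rw [min_eq_left hy, max_eq_right zero_le_one, mul_one]
  simpa using h1.add hclu

/-- This makes conjugation by a homeomorphism uniformly close to the identity a small perturbation.
-/
lemma CI.uniformContinuous_coord (f : CI) : UniformContinuous f.coord := by
  simpa using ((f.continuous_coord.sub continuous_id).uniformContinuous_of_tendsto_atBot_atTop
    f.tendsto_disp_atBot f.tendsto_disp_atTop).add uniformContinuous_id

/-- Conjugation by a map asymptotic to the identity preserves the limits of the displacement. -/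
lemma tendsto_disp_conj {l : Filter ℝ} {F : ℝ → ℝ} {c : ℝ ≃o ℝ} {a : ℝ}
    (hc : ∀ᶠ y in l, c y = y) (hF : Tendsto F l l) (ha : Tendsto (fun y => F y - y) l (𝓝 a)) :
    Tendsto (fun y => c (F (c.symm y)) - y) l (𝓝 a) := by
  refine ha.congr' ?_
  filter_upwards [hc, hF.eventually hc] with y h1 h2
  rw [show c.symm y = y by rw [OrderIso.symm_apply_eq, h1], h2]

namespace RDS

variable (f : RDS)

/-- Conjugation keeps the order relations to the diagonal, and since `c` is the identity near both
ends it leaves the Lyapunov exponents unchanged. -/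
lemma exists_conj {c : ℝ ≃o ℝ} (hbot : ∀ᶠ y in atBot, c y = y) (htop : ∀ᶠ y in atTop, c y = y) :
    ∃ g : RDS, (∀ y, g.f₀.coord y = c (f.f₀.coord (c.symm y))) ∧
      (∀ y, g.f₁.coord y = c (f.f₁.coord (c.symm y))) ∧ g.p = f.p := by
  have cont : ∀ g : CI, Continuous fun y => c (g.coord (c.symm y)) := fun g =>
    c.continuous.comp (g.continuous_coord.comp c.symm.continuous)
  have mono : ∀ {F : ℝ → ℝ}, StrictMono F → StrictMono fun y => c (F (c.symm y)) := fun hF =>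
    c.strictMono.comp (hF.comp c.symm.strictMono)
  obtain ⟨g, h0, h1, hp⟩ := exists_of_coord (p := f.p) (cont f.f₀) (cont f.f₁)
    (mono f.strictMono_coord₀) (mono f.strictMono_coord₁)
    (fun y => by rw [← OrderIso.lt_symm_apply]; exact f.coord₀_lt _)
    (fun y => by rw [← OrderIso.symm_apply_lt]; exact f.lt_coord₁ _)
    (tendsto_disp_conj hbot f.f₀.tendsto_coord_atBot f.f₀.tendsto_disp_atBot)
    (tendsto_disp_conj hbot f.f₁.tendsto_coord_atBot f.f₁.tendsto_disp_atBot)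
    (tendsto_disp_conj htop f.f₀.tendsto_coord_atTop f.f₀.tendsto_disp_atTop)
    (tendsto_disp_conj htop f.f₁.tendsto_coord_atTop f.f₁.tendsto_disp_atTop) f.2.prob
    f.2.lyapunov_zero (by
      have : 0 < f.p * Real.log (derivI f.f₀.toMap 1) +
        (1 - f.p) * Real.log (derivI f.f₁.toMap 1) := f.2.lyapunov_one
      linarith)
  exact ⟨g, congrFun h0, congrFun h1, hp⟩

variable {f}

/-- The transported distribution function `f.statCDF ∘ c.symm` is fixed by the transfer operator of
`g`, so uniqueness applies. -/
lemma lineMeasure_of_conj {g : RDS} {c : ℝ ≃o ℝ}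
    (h0 : ∀ y, g.f₀.coord y = c (f.f₀.coord (c.symm y)))
    (h1 : ∀ y, g.f₁.coord y = c (f.f₁.coord (c.symm y))) (hp : g.p = f.p) :
    g.lineMeasure = f.lineMeasure.map c := by
  have hs := f.isStationaryCDF_statCDF
  have i0 : ∀ y, c.symm (g.inv₀ y) = f.inv₀ (c.symm y) := fun y => by
    rw [← f.inv₀_coord₀ (c.symm (g.inv₀ y))]
    congr 1
    rw [← c.apply_eq_iff_eq, ← h0, coord₀_inv₀, c.apply_symm_apply]
  have i1 : ∀ y, c.symm (g.inv₁ y) = f.inv₁ (c.symm y) := fun y => by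
    rw [← f.inv₁_coord₁ (c.symm (g.inv₁ y))]
    congr 1
    rw [← c.apply_eq_iff_eq, ← h1, coord₁_inv₁, c.apply_symm_apply]
  have hconj : g.IsStationaryCDF fun y => f.statCDF (c.symm y) :=
    { continuous := hs.continuous.comp c.symm.continuous
      monotone := hs.monotone.comp c.symm.monotone
      tendsto_atBot := hs.tendsto_atBot.comp c.symm.tendsto_atBot
      tendsto_atTop := hs.tendsto_atTop.comp c.symm.tendsto_atTop
      transfer_eq := fun y => by
        rw [transfer, i0, i1, hp]
        exact f.statCDF_eq _ }
  have hm : Measurable c := c.continuous.measurable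
  have : IsProbabilityMeasure (f.lineMeasure.map c) :=
    Measure.isProbabilityMeasure_map hm.aemeasurable
  refine Measure.eq_of_cdf _ _ (StieltjesFunction.ext fun y => ?_)
  rw [cdf_lineMeasure, g.isStationaryCDF_statCDF.unique hconj, cdf_eq_real, Measure.real,
    Measure.map_apply hm measurableSet_Iic, ← f.cdf_lineMeasure]
  dsimp only
  rw [cdf_eq_real, Measure.real]
  congr 2
  ext z
  simp only [mem_Iic, mem_preimage]
  exact OrderIso.le_symm_apply c

end RDS

/-! ### Step-like maps close to the identity -/

/-- A continuous nondecreasing map that is close to a step function with steps of length `η` on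
`[-n η, n η]` and is the identity elsewhere; the ramps have length `θ`. -/
noncomputable def stairs (n : ℕ) (η θ y : ℝ) : ℝ :=
  min y (-(n * η)) + max (y - n * η) 0 +
    ∑ k ∈ Finset.range (2 * n), η * max 0 (min 1 ((y - (k - n) * η) / θ))

variable {n : ℕ} {η θ : ℝ}

lemma continuous_stairs : Continuous (stairs n η θ) := by
  unfold stairs; fun_prop

lemma monotone_stairs (hη : 0 < η) (hθ : 0 < θ) : Monotone (stairs n η θ) := by
  intro x y hxy
  refine add_le_add (add_le_add (min_le_min hxy le_rfl) (max_le_max (by linarith) le_rfl))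
    (Finset.sum_le_sum fun k _ => mul_le_mul_of_nonneg_left
      (max_le_max le_rfl (min_le_min le_rfl ?_)) hη.le)
  exact div_le_div_of_nonneg_right (by linarith) hθ.le

lemma stairs_of_le (hη : 0 < η) (hθ : 0 < θ) {y : ℝ} (hy : y ≤ -(n * η)) :
    stairs n η θ y = y := by
  have hn : 0 ≤ (n : ℝ) * η := by positivity
  rw [stairs, min_eq_left hy, max_eq_right (by linarith), Finset.sum_eq_zero, add_zero, add_zero]
  intro k _
  have hk : 0 ≤ (k : ℝ) * η := by positivity
  rw [max_eq_left, mul_zero]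
  exact (min_le_right _ _).trans (div_nonpos_of_nonpos_of_nonneg (by linarith) hθ.le)

lemma ramp_eq_one (hθ : 0 < θ) {y s : ℝ} (hy : s + θ ≤ y) :
    max 0 (min 1 ((y - s) / θ)) = 1 := by
  rw [min_eq_left ((one_le_div hθ).2 (by linarith)), max_eq_right zero_le_one]

lemma ramp_eq_zero (hθ : 0 < θ) {y s : ℝ} (hy : y ≤ s) :
    max 0 (min 1 ((y - s) / θ)) = 0 :=
  max_eq_left ((min_le_right _ _).trans (div_nonpos_of_nonpos_of_nonneg (by linarith) hθ.le))

/-- All `2 * n` ramps are complete, the last one because `θ ≤ η`. Their total `2 * n * η` cancels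
the two terms `-(n * η)`. -/
lemma stairs_of_ge (hη : 0 < η) (hθ : 0 < θ) (hθη : θ ≤ η) {y : ℝ} (hy : n * η ≤ y) :
    stairs n η θ y = y := by
  have hn : 0 ≤ (n : ℝ) * η := by positivity
  rw [stairs, min_eq_right (by linarith), max_eq_left (by linarith),
    Finset.sum_congr rfl (g := fun _ => η) fun k hk => ?_]
  · rw [Finset.sum_const, Finset.card_range, nsmul_eq_mul]
    push_cast; ring
  · have hk' : (k : ℝ) + 1 ≤ 2 * n := by exact_mod_cast Finset.mem_range.1 hk
    have := mul_le_mul_of_nonneg_right hk' hη.le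
    rw [ramp_eq_one hθ (by linarith), mul_one]

/-- On this flat part exactly the first `j` ramps are complete and the others have not begun. -/
lemma stairs_eq (hη : 0 < η) (hθ : 0 < θ) {j : ℕ} (hj : j ≤ 2 * n) {y : ℝ}
    (h1 : (j - n) * η - η + θ ≤ y) (h2 : y ≤ (j - n) * η) (h3 : -(n * η) ≤ y) :
    stairs n η θ y = (j - n) * η := by
  have hj' : (j : ℝ) ≤ 2 * n := by exact_mod_cast hj
  have hjη := mul_le_mul_of_nonneg_right hj' hη.le
  have hsum : ∑ k ∈ Finset.range (2 * n), η * max 0 (min 1 ((y - (k - n) * η) / θ)) =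
      ∑ k ∈ Finset.range (2 * n), if k < j then η else 0 := by
    refine Finset.sum_congr rfl fun k _ => ?_
    split_ifs with hk
    · have hk' : (k : ℝ) + 1 ≤ j := by exact_mod_cast hk
      have := mul_le_mul_of_nonneg_right hk' hη.le
      rw [ramp_eq_one hθ (by linarith), mul_one]
    · have hk' : (j : ℝ) ≤ k := by exact_mod_cast not_lt.1 hk
      have := mul_le_mul_of_nonneg_right hk' hη.le
      rw [ramp_eq_zero hθ (by linarith), mul_zero]
  have hfil : (Finset.range (2 * n)).filter (· < j) = Finset.range j := by
    ext k
    simp only [Finset.mem_filter, Finset.mem_range]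
    omega
  rw [stairs, min_eq_right h3, max_eq_right (by linarith), hsum, ← Finset.sum_filter, hfil,
    Finset.sum_const, Finset.card_range, nsmul_eq_mul]
  ring

lemma exists_cell (hη : 0 < η) {y : ℝ} (h1 : -(n * η) < y) (h2 : y ≤ n * η) :
    ∃ k < 2 * n, (k - n) * η < y ∧ y ≤ (((k + 1 : ℕ) : ℝ) - n) * η := by
  have hpos : 0 < (y + n * η) / η := div_pos (by linarith) hη
  have hc := Nat.ceil_pos.2 hpos
  have a1 := Nat.le_ceil ((y + n * η) / η)
  have a2 := Nat.ceil_lt_add_one hpos.le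
  obtain ⟨k, hk⟩ := Nat.exists_eq_add_of_lt hc
  rw [zero_add] at hk
  have hle : ⌈(y + n * η) / η⌉₊ ≤ 2 * n := by
    refine Nat.ceil_le.2 ?_
    rw [div_le_iff₀ hη]; push_cast; linarith
  rw [hk] at a1 a2 hle
  rw [div_le_iff₀ hη] at a1
  push_cast at a2
  have a3 := (lt_div_iff₀ hη).1 (by linarith : (k : ℝ) < (y + n * η) / η)
  push_cast at a1 ⊢
  exact ⟨k, by omega, by linarith, by linarith⟩

/-- The grid points are fixed, so by monotonicity a point and its image lie in the same cell of
length `η`. -/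
lemma abs_stairs_sub_le (hη : 0 < η) (hθ : 0 < θ) (hθη : θ ≤ η) (y : ℝ) :
    |stairs n η θ y - y| ≤ η := by
  rcases le_or_gt y (-(n * η)) with h1 | h1
  · rw [stairs_of_le hη hθ h1, sub_self, abs_zero]; exact hη.le
  rcases le_or_gt (n * η) y with h2 | h2
  · rw [stairs_of_ge hη hθ hθη h2, sub_self, abs_zero]; exact hη.le
  obtain ⟨k, hk, hk1, hk2⟩ := exists_cell hη h1 h2.le
  have grid : ∀ j : ℕ, j ≤ 2 * n → stairs n η θ ((j - n) * η) = (j - n) * η := fun j hj => by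
    have : 0 ≤ (j : ℝ) * η := by positivity
    exact stairs_eq hη hθ hj (by linarith) le_rfl (by linarith)
  have m1 := monotone_stairs (n := n) hη hθ hk1.le
  have m2 := monotone_stairs (n := n) hη hθ hk2
  rw [grid k hk.le] at m1
  rw [grid (k + 1) hk] at m2
  push_cast at m2 hk2
  rw [abs_le]
  constructor <;> linarith

/-- The values of `stairs` on its flat parts. -/
noncomputable def stairValues (n : ℕ) (η : ℝ) : Set ℝ :=
  ↑((Finset.range (2 * n + 1)).image fun j : ℕ => ((j : ℝ) - n) * η)

lemma Ioc_subset_preimage_stairs (hη : 0 < η) (hθ : 0 < θ) :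
    Ioc (-(n * η)) (n * η) ⊆ stairs n η θ ⁻¹' stairValues n η ∪
      ⋃ k ∈ Finset.range (2 * n), Ioc (((k : ℝ) - n) * η) ((k - n) * η + θ) := by
  intro y hy
  obtain ⟨k, hk, hk1, hk2⟩ := exists_cell hη hy.1 hy.2
  rcases le_or_gt y ((k - n) * η + θ) with h | h
  · exact Or.inr (mem_biUnion (by simpa using hk) ⟨hk1, h⟩)
  · refine Or.inl ?_
    rw [mem_preimage, stairs_eq hη hθ (j := k + 1) hk (by push_cast; linarith) hk2 hy.1.le]
    exact Finset.mem_coe.2 (Finset.mem_image_of_mem _ (by simpa using hk))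

/-! ### Density of nearly singular systems -/

namespace RDS

variable (f : RDS)

/-- First `n` is taken so large that less than `ε / 2` of the mass lies outside the staircase. Then
`θ` is taken so small that the ramps carry less than `ε / 2`, which is possible because the
distribution function is continuous. -/
lemma exists_stairs (hη : 0 < η) {ε : ℝ} (hε : 0 < ε) (hε1 : ε ≤ 1) :
    ∃ (n : ℕ) (θ : ℝ), 0 < θ ∧ θ ≤ η ∧
      ENNReal.ofReal (1 - ε) < f.lineMeasure (stairs n η θ ⁻¹' stairValues n η) := by
  have hs := f.isStationaryCDF_statCDF
  have t1 : Tendsto (fun n : ℕ => (n : ℝ) * η) atTop atTop :=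
    tendsto_natCast_atTop_atTop.atTop_mul_const hη
  have t2 := (hs.tendsto_atTop.comp t1).sub
    (hs.tendsto_atBot.comp (tendsto_neg_atTop_atBot.comp t1))
  rw [sub_zero] at t2
  obtain ⟨n, hn⟩ := (t2.eventually_const_lt (show 1 - ε / 2 < 1 by linarith)).exists
  simp only [Function.comp] at hn
  have t3 : Tendsto (fun θ : ℝ => ∑ k ∈ Finset.range (2 * n),
      (f.statCDF ((k - n) * η + θ) - f.statCDF ((k - n) * η))) (𝓝[>] 0) (𝓝 0) := by
    have hc := hs.continuous
    have : Continuous fun θ : ℝ => ∑ k ∈ Finset.range (2 * n),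
      (f.statCDF ((k - n) * η + θ) - f.statCDF ((k - n) * η)) := by fun_prop
    have h0 := this.tendsto 0
    simp only [add_zero, sub_self, Finset.sum_const_zero] at h0
    exact h0.mono_left nhdsWithin_le_nhds
  obtain ⟨θ, hθ1, hθ⟩ := ((t3.eventually_lt_const (show 0 < ε / 2 by linarith)).and
    (Ioc_mem_nhdsGT hη)).exists
  refine ⟨n, θ, hθ.1, hθ.2, ?_⟩
  have h1 := measure_mono (μ := f.lineMeasure)
    (Ioc_subset_preimage_stairs (n := n) hη hθ.1)
  have h2 : f.lineMeasure (⋃ k ∈ Finset.range (2 * n),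
      Ioc (((k : ℝ) - n) * η) ((k - n) * η + θ)) ≤ ENNReal.ofReal (ε / 2) := by
    refine (measure_biUnion_finset_le _ _).trans ?_
    simp_rw [lineMeasure_Ioc]
    rw [← ENNReal.ofReal_sum_of_nonneg fun k _ => sub_nonneg.2 (hs.monotone (by linarith [hθ.1]))]
    exact ENNReal.ofReal_le_ofReal hθ1.le
  have h3 := h1.trans ((measure_union_le _ _).trans (add_le_add le_rfl h2))
  rw [lineMeasure_Ioc] at h3
  by_contra! h4
  have h5 := h3.trans (add_le_add h4 le_rfl)
  rw [← ENNReal.ofReal_add (by linarith) (by linarith)] at h5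
  have := (ENNReal.ofReal_le_ofReal_iff (by linarith)).1 h5
  linarith

/-- Homeomorphisms of the line, close to the identity, that move almost all of the stationary
measure to an open set of small Lebesgue measure. -/
lemma exists_concentrating (hη : 0 < η) {ε : ℝ} (hε : 0 < ε) (hε1 : ε ≤ 1) :
    ∃ c : ℝ ≃o ℝ, (∀ y, |c y - y| ≤ η) ∧ (∀ᶠ y in atBot, c y = y) ∧ (∀ᶠ y in atTop, c y = y) ∧
      ∃ U : Set ℝ, IsOpen U ∧ lebLine U < ENNReal.ofReal ε ∧
        ENNReal.ofReal (1 - ε) < f.lineMeasure (c ⁻¹' U) := by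
  obtain ⟨n, θ, hθ, hθη, hmass⟩ := f.exists_stairs hη hε hε1
  have hfin : (stairValues n η).Finite := Finset.finite_toSet _
  -- The values on the flat parts form a finite, hence Lebesgue null, set.
  obtain ⟨U, hPU, hU, hUl⟩ := (stairValues n η).exists_isOpen_lt_of_lt (μ := lebLine)
    (ENNReal.ofReal ε) (by rw [hfin.measure_zero]; exact ENNReal.ofReal_pos.2 hε)
  obtain ⟨r, hr, hrU⟩ := hfin.isCompact.exists_thickening_subset_open hU hPU
  -- Mixing in `τ` times the identity makes the staircase strictly increasing and moves its values
  -- by at most `τ * η < r`, so the flat parts still land in `U`.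
  obtain ⟨τ, hτ0, hτ1⟩ := exists_between (show 0 < min 1 (r / η) from lt_min one_pos (div_pos hr hη))
  have hτ1' : τ < 1 := hτ1.trans_le (min_le_left _ _)
  have hτr : τ * η < r := (lt_div_iff₀ hη).1 (hτ1.trans_le (min_le_right _ _))
  set c : ℝ → ℝ := fun y => (1 - τ) * stairs n η θ y + τ * y with hc
  have hmono : StrictMono c := fun x y hxy =>
    add_lt_add_of_le_of_lt
      (mul_le_mul_of_nonneg_left (monotone_stairs hη hθ hxy.le) (sub_pos.2 hτ1').le)
      (mul_lt_mul_of_pos_left hxy hτ0)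
  have hbot : ∀ᶠ y in atBot, c y = y := by
    filter_upwards [eventually_le_atBot (-(n * η))] with y hy
    simp only [hc]
    rw [stairs_of_le hη hθ hy]; ring
  have htop : ∀ᶠ y in atTop, c y = y := by
    filter_upwards [eventually_ge_atTop (n * η)] with y hy
    simp only [hc]
    rw [stairs_of_ge hη hθ hθη hy]; ring
  have hcont : Continuous c :=
    (continuous_const.mul continuous_stairs).add (continuous_const.mul continuous_id)
  have hsurj : Function.Surjective c := hcont.surjective
    (tendsto_id.congr' (htop.mono fun y hy => hy.symm))
    (tendsto_id.congr' (hbot.mono fun y hy => hy.symm))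
  refine ⟨hmono.orderIsoOfSurjective c hsurj, fun y => ?_, hbot, htop, U, hU, hUl,
    hmass.trans_le (measure_mono fun y hy => ?_)⟩
  · have e : c y - y = (1 - τ) * (stairs n η θ y - y) := by simp only [hc]; ring
    rw [StrictMono.coe_orderIsoOfSurjective, e, abs_mul, abs_of_pos (sub_pos.2 hτ1')]
    have := abs_stairs_sub_le (n := n) hη hθ hθη y
    nlinarith [abs_nonneg (stairs n η θ y - y)]
  · refine hrU (Metric.mem_thickening_iff.2 ⟨_, hy, ?_⟩)
    have e : c y - stairs n η θ y = -(τ * (stairs n η θ y - y)) := by simp only [hc]; ring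
    rw [StrictMono.coe_orderIsoOfSurjective, Real.dist_eq, e, abs_neg, abs_mul, abs_of_pos hτ0]
    exact (mul_le_mul_of_nonneg_left (abs_stairs_sub_le hη hθ hθη y) hτ0.le).trans_lt hτr

/-- The systems whose stationary measure is nearly singular are dense. -/
lemma dense_nearlySingular {ε : ℝ} (hε : 0 < ε) (hε1 : ε ≤ 1) : Dense (nearlySingular ε) := by
  refine Metric.dense_iff.2 fun f r hr => ?_
  obtain ⟨η₀, hη₀, hu₀⟩ := Metric.uniformContinuous_iff.1 f.f₀.uniformContinuous_coord (r / 4)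
    (by positivity)
  obtain ⟨η₁, hη₁, hu₁⟩ := Metric.uniformContinuous_iff.1 f.f₁.uniformContinuous_coord (r / 4)
    (by positivity)
  obtain ⟨η, hη, hηlt⟩ := exists_between (lt_min (lt_min hη₀ hη₁) (show 0 < r / 4 by positivity))
  obtain ⟨c, hc, hbot, htop, U, hU, hUl, hUm⟩ := f.exists_concentrating hη hε hε1
  obtain ⟨g, hg₀, hg₁, hgp⟩ := f.exists_conj hbot htop
  -- The outer `c` costs at most `η < r / 4`; the inner `c.symm` moves the argument by at most `η`,
  -- which costs `r / 4` by uniform continuity.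
  have key : ∀ {F : ℝ → ℝ} {δ : ℝ}, η < δ →
      (∀ ⦃a b : ℝ⦄, dist a b < δ → dist (F a) (F b) < r / 4) →
      ∀ y, |c (F (c.symm y)) - F y| ≤ r / 2 := by
    intro F δ hδ hF y
    have h1 := hc (c.symm y)
    rw [c.apply_symm_apply, abs_sub_comm] at h1
    have h2 := hF (a := c.symm y) (b := y) (by rw [Real.dist_eq]; linarith)
    have h3 := hc (F (c.symm y))
    have h4 := hηlt.trans_le (min_le_right _ _)
    have h5 := abs_sub_le (c (F (c.symm y))) (F (c.symm y)) (F y)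
    rw [Real.dist_eq] at h2
    linarith
  refine ⟨g, ?_, ?_⟩
  · refine (dist_le_of_coord (r := r / 2) (fun y => ?_) (fun y => ?_) hgp).trans_lt (by linarith)
    · rw [hg₀]
      exact key (hηlt.trans_le ((min_le_left _ _).trans (min_le_left _ _))) hu₀ y
    · rw [hg₁]
      exact key (hηlt.trans_le ((min_le_left _ _).trans (min_le_right _ _))) hu₁ y
  · refine mem_nearlySingular_of_isOpen hε1 hU hUl ?_
    rwa [lineMeasure_of_conj hg₀ hg₁ hgp,
      Measure.map_apply c.continuous.measurable hU.measurableSet]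

lemma isTypical_mem_residual : {f : RDS | f.IsTypical} ∈ residual RDS := by
  rw [setOf_isTypical_eq]
  refine inter_mem (countable_iInter_mem.2 fun n => ?_)
    (residual_of_dense_Gδ isGδ_strictMono_statCDF dense_strictMono_statCDF)
  exact residual_of_dense_open (isOpen_nearlySingular _)
    (dense_nearlySingular (by positivity) (pow_le_one₀ (by norm_num) (by norm_num)))

end RDS

end IntervalRDS

open IntervalRDS
theorem mainTheorem1 :
    -- `RDS(I)` is a Baire space
    BaireSpace RDS ∧
    -- every system has a unique stationary probability measure on `(0, 1)`, and it is atomless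
    (∀ f : RDS, (∃! μ : ProbabilityMeasure OpenI, f.IsStationary μ) ∧
      ∀ μ : ProbabilityMeasure OpenI, f.IsStationary μ → ∀ x, (μ : Measure OpenI) {x} = 0) ∧
    -- the systems whose unique stationary measure is singular, atomless and has full support
    -- form a dense `G_δ` set; in particular, this set is residual
    IsGδ {f : RDS | f.IsTypical} ∧ Dense {f : RDS | f.IsTypical} ∧
    {f : RDS | f.IsTypical} ∈ residual RDS := by
  refine ⟨inferInstance, fun f => ⟨⟨f.statMeasure, f.isStationary_statMeasure,
    fun ν hν => hν.eq_statMeasure⟩, fun μ hμ x => ?_⟩, RDS.isGδ_isTypical,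
    dense_of_mem_residual RDS.isTypical_mem_residual, RDS.isTypical_mem_residual⟩
  rw [hμ.eq_statMeasure]
  exact f.statMeasure_singleton x
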